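/- Let $n\in\mathbb N$ and $\beta\in[0,1)$. Let $\Omega\subset\mathbb R^n$ be a nonempty bounded open convex set with $C^1$ boundary that is strongly convex, in the (weak) sense that $\partial\Omega$ contains no segment. Let $a\in C^1(\Omega)$ with $a>0$, let $\alpha^{ij}\in C^1(\Omega)$, $1\le i,j\le n$, satisfy $\sum_{i,j}\alpha^{ij}(x)p_ip_j\ge\zeta|p|^2$ for all $x\in\Omega$, $p\in\mathbb R^n$ and some $\zeta>0$, and let $u\in C^2(\Omega)\cap C^1(\overline\Omega)$ satisfy $$-\sum_{i,j=1}^n\alpha^{ij}(x)D^2_{ij}u=a(x)u^\beta\ \text{ in }\Omega,\qquad u>0\ \text{ in }\Omega,\qquad u=0\ \text{ on }\partial\Omega .$$ Put $v:=-u^{(1-\beta)/2}$, $\mathcal C_v(x_1,x_3,t):=v(tx_3+(1-t)x_1)-t\,v(x_3)-(1-t)v(x_1)$ on $\overline\Omega\times\overline\Omega\times[0,1]$, and $G:=\|\nabla a\|_{L^\infty(\Omega)}+\max_{i,j}\|\nabla\alpha^{ij}\|_{L^\infty(\Omega)}$, and assume $G<\infty$. Then there is a constant $C>0$, independent of $\epsilon$,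 such that for every $\epsilon>0$ with $G<\epsilon$, $$\max_{\overline\Omega\times\overline\Omega\times[0,1]}\mathcal C_{v}\le C\epsilon ,$$ and there is a concave function $w:\Omega\to\mathbb R$ with $\sup_{\Omega}|u^{(1-\beta)/2}-w|\le C\epsilon$. The dependence of $C$ is as follows. For $\rho>0$ let $\Omega^\rho:=\{x\in\Omega: d(x,\partial\Omega)\ge\rho\}$, and say that $(\rho,K)$ controls $(\Omega,a,\alpha,u)$ if $\mathcal C_v$ attains its maximum over $\overline\Omega\times\overline\Omega\times[0,1]$ at some $(x_1,x_3,t)$ with $x_1,x_3\in\Omega^\rho$, if $\operatorname{diam}\Omega\le K$, and if $K^{-1}\le a\le K$, $|\alpha^{ij}|\le K$, $K^{-1}\le u\le K$, $|Du|\le K$, $|D^2_{ij}u|\le K$ on $\Omega^\rho$ for all $i,j$. Then every $(\Omega,a,\alpha,u)$ as above is controlled by some pair $(\rho,K)$ with $\rho>0$, and the two estimates hold with $C=C(n,\beta,K)$ for every pair $(\rho,K)$, $\rho>0$, that controls it; the function $C(n,\beta,\cdot)>0$ depends on nothing else. -/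

import Mathlib

open scoped ENNReal Topology

namespace AlmostConcave

noncomputable section

/-- The Euclidean space `ℝⁿ`. -/
abbrev E (n : ℕ) : Type := EuclideanSpace ℝ (Fin n)

/-- The first partial derivative `D_i f (x)`. -/
def partialD {n : ℕ} (i : Fin n) (f : E n → ℝ) (x : E n) : ℝ :=
  fderiv ℝ f x (EuclideanSpace.single i 1)

/-- The second partial derivative `D²_{ij} f (x)`. -/
def partialD2 {n : ℕ} (i j : Fin n) (f : E n → ℝ) (x : E n) : ℝ :=
  partialD i (partialD j f) x

/-- The concavity function
`C_w(x₁, x₃, t) = w (t x₃ + (1 - t) x₁) - t w(x₃) - (1 - t) w(x₁)`. -/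
def concavityFn {n : ℕ} (w : E n → ℝ) (q : E n × E n × ℝ) : ℝ :=
  w (q.2.2 • q.2.1 + (1 - q.2.2) • q.1) - q.2.2 * w q.2.1 - (1 - q.2.2) * w q.1

/-- The set `Ω̄ × Ω̄ × [0,1]` on which concavity functions are considered. -/
def triples {n : ℕ} (Ω : Set (E n)) : Set (E n × E n × ℝ) :=
  closure Ω ×ˢ closure Ω ×ˢ Set.Icc (0 : ℝ) 1

/-- `∂Ω` is of class `C¹`: near each boundary point, `Ω` is the sublevel set `{φ < 0}` of a `C¹`
function `φ` with nonzero differential at that point. -/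
def HasC1Boundary {n : ℕ} (Ω : Set (E n)) : Prop :=
  ∀ x ∈ frontier Ω, ∃ φ : E n → ℝ,
    ContDiffAt ℝ 1 φ x ∧ fderiv ℝ φ x ≠ 0 ∧ ∀ᶠ y in 𝓝 x, (y ∈ Ω ↔ φ y < 0)

/-- Admissible domains: nonempty bounded open convex sets with `C¹` boundary, whose boundary
contains no segment. (Strict convexity has to be imposed on the closure: every open convex set is
strictly convex in the sense of `StrictConvex`.) -/
structure IsAdmissibleDomain {n : ℕ} (Ω : Set (E n)) : Prop where
  nonempty : Ω.Nonempty
  isOpen : IsOpen Ω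
  isBounded : Bornology.IsBounded Ω
  convex : Convex ℝ Ω
  strictConvex_closure : StrictConvex ℝ (closure Ω)
  c1_boundary : HasC1Boundary Ω

/-- `u ∈ C²(Ω) ∩ C¹(Ω̄)` is a positive solution of `-∑ α^{ij} D²_{ij} u = a u^β` in `Ω`, `u = 0` on
`∂Ω`, where `a > 0` and `α^{ij}` are of class `C¹` in `Ω` and `(α^{ij})` is uniformly elliptic. -/
structure IsSolution {n : ℕ} (Ω : Set (E n)) (β : ℝ) (a : E n → ℝ)
    (α : Fin n → Fin n → E n → ℝ) (u : E n → ℝ) : Prop where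
  a_pos : ∀ x ∈ Ω, 0 < a x
  a_C1 : ContDiffOn ℝ 1 a Ω
  α_C1 : ∀ i j, ContDiffOn ℝ 1 (α i j) Ω
  elliptic : ∃ ζ : ℝ, 0 < ζ ∧ ∀ x ∈ Ω, ∀ p : E n, ζ * ‖p‖ ^ 2 ≤ ∑ i, ∑ j, α i j x * p i * p j
  u_C2 : ContDiffOn ℝ 2 u Ω
  u_C1_closure : ContDiffOn ℝ 1 u (closure Ω)
  u_pos : ∀ x ∈ Ω, 0 < u x
  u_boundary : ∀ x ∈ frontier Ω, u x = 0
  equation : ∀ x ∈ Ω, -(∑ i, ∑ j, α i j x * partialD2 i j u x) = a x * u x ^ β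

/-- `‖∇a‖_{L^∞(Ω)} + max_{i,j} ‖∇α^{ij}‖_{L^∞(Ω)}`, as an extended nonnegative number. -/
def variation {n : ℕ} (Ω : Set (E n)) (a : E n → ℝ) (α : Fin n → Fin n → E n → ℝ) : ℝ≥0∞ :=
  MeasureTheory.eLpNorm (gradient a) ∞ (MeasureTheory.volume.restrict Ω) +
    ⨆ i, ⨆ j, MeasureTheory.eLpNorm (gradient (α i j)) ∞ (MeasureTheory.volume.restrict Ω)

/-- The transformed solution `v = -u^{(1-β)/2}`. -/
def transform {n : ℕ} (β : ℝ) (u : E n → ℝ) (x : E n) : ℝ := -(u x ^ ((1 - β) / 2))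

/-- The set of points of `Ω` whose distance to `∂Ω` is at least `ρ`. -/
def innerSet {n : ℕ} (Ω : Set (E n)) (ρ : ℝ) : Set (E n) :=
  {x ∈ Ω | ρ ≤ Metric.infDist x (frontier Ω)}

/-- `(ρ, K)` controls `(Ω, a, α, u)`: the concavity function of `v = -u^{(1-β)/2}` has a maximum
point `(x₁, x₃, t)` with `x₁, x₃` at distance at least `ρ` from `∂Ω`, and `K` bounds the diameter of
`Ω` and, on the set of points at distance at least `ρ` from `∂Ω`, the quantities `a`, `1/a`,
`|α^{ij}|`, `u`, `1/u`, `|Du|` and `|D²_{ij} u|`. -/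
structure IsControl {n : ℕ} (Ω : Set (E n)) (β : ℝ) (a : E n → ℝ)
    (α : Fin n → Fin n → E n → ℝ) (u : E n → ℝ) (ρ K : ℝ) : Prop where
  exists_max : ∃ x₁ ∈ innerSet Ω ρ, ∃ x₃ ∈ innerSet Ω ρ, ∃ t ∈ Set.Icc (0 : ℝ) 1,
    IsMaxOn (concavityFn (transform β u)) (triples Ω) (x₁, x₃, t)
  diam_le : Metric.diam Ω ≤ K
  a_bounds : ∀ x ∈ innerSet Ω ρ, K⁻¹ ≤ a x ∧ a x ≤ K
  α_bound : ∀ x ∈ innerSet Ω ρ, ∀ i j, |α i j x| ≤ K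
  u_bounds : ∀ x ∈ innerSet Ω ρ, K⁻¹ ≤ u x ∧ u x ≤ K
  Du_bound : ∀ x ∈ innerSet Ω ρ, ‖gradient u x‖ ≤ K
  D2u_bound : ∀ x ∈ innerSet Ω ρ, ∀ i j, |partialD2 i j u x| ≤ K

end

end AlmostConcave

/-!
Put `γ = (1 - β) / 2`, so that `v = -u ^ γ`. The equation for `u` turns into
`∑ α^{ij} D²_{ij} v = B / (-v)` with `B = (1/γ - 1) ∑ α^{ij} D_i v D_j v + γ a`
(`sum_mul_hessPow`). For fixed coefficients and fixed gradient the reciprocal of the right-hand side is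
linear in `v`, and this is the structure behind Korevaar's and Kennington's concavity maximum
principle.

*Interior estimate* (`concavityFn_le_of_isControl`). At a maximum `(x₁, x₃, t)` of the concavity
function with `x₁`, `x₃` in `Ω` and `0 < t < 1`, the gradients of `v` at `x₁`, `x₃` and
`x₂ = t x₃ + (1 - t) x₁` coincide. Moving `x₁` and `x₃` with velocities `m₁ h` and `m₃ h` gives a
negative semidefinite combination of the three Hessians, whose trace against the elliptic matrix
`α(x₂)` is nonpositive (`trace_le_at_max`). Replacing `α(x₂)` by `α(x₁)`, `α(x₃)` and `B(x₁)`, `B(x₃)`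
by `B(x₂)` costs `O(ε)`, because `a` and `α` are `ε`-Lipschitz. The weights `m₁ = -v(x₁)`,
`m₃ = -v(x₃)` then give `v(x₂) - t v(x₃) - (1 - t) v(x₁) = O(ε)`
(`defect_le_of_weighted_trace_le`). The ellipticity constant plays no role: only the semidefiniteness
of `α(x₂)` is used.

*The maximum is attained in the interior* (`exists_interior_max`). If both end points lie on the
boundary, the value is `v(x₂) < 0`. If only `x₁` does, `v` has slope `-∞` at `x₁` towards `x₃`, and
moving `x₁` inwards increases the value. Hopf's lemma may fail on `C¹` domains, so this slope is
obtained from a weaker growth estimate `u(x₁ + s (x₃ - x₁)) ≥ c s ^ (7/4)`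
(`exists_mul_rpow_le_of_mem_frontier`), which suffices since `7/4 * γ ≤ 7/8 < 1`. It follows by
comparison with a `7/4`-homogeneous strict subsolution in a cone close to a half-space, and `Ω`
contains truncations of such cones because its boundary is `C¹`.

*Concave approximation* (`exists_convexOn_near_of_approx_convex`). A function that is convex up to an
error `δ` is within `(n + 2) δ` of its convex envelope, by Carathéodory's theorem.
-/

namespace AlmostConcave

/-! ### A trace inequality -/

/-- The trace of the product of a matrix with nonnegative quadratic form, not necessarily symmetric,
and a symmetric positive semidefinite matrix `B = Dᵀ D` is the sum of the values of the first form at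
the rows of `D`. -/
theorem sum_mul_nonneg_of_quadratic_nonneg {n : ℕ} (A B : Fin n → Fin n → ℝ)
    (hA : ∀ p : Fin n → ℝ, 0 ≤ ∑ i, ∑ j, A i j * p i * p j)
    (hBs : ∀ i j, B i j = B j i)
    (hB : ∀ p : Fin n → ℝ, 0 ≤ ∑ i, ∑ j, B i j * p i * p j) :
    0 ≤ ∑ i, ∑ j, A i j * B i j := by
  have hP : (Matrix.of B).PosSemidef := by
    refine Matrix.PosSemidef.of_dotProduct_mulVec_nonneg ?_ ?_
    · ext i j
      simp [Matrix.conjTranspose_apply, hBs i j]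
    · intro x
      have := hB x
      simp only [dotProduct, Matrix.mulVec, Matrix.of_apply, star_trivial, Finset.mul_sum]
      refine this.trans_eq (Finset.sum_congr rfl fun i _ => Finset.sum_congr rfl fun j _ => ?_)
      ring
  open scoped MatrixOrder in
  obtain ⟨D, hD⟩ := CStarAlgebra.nonneg_iff_eq_star_mul_self.mp hP.nonneg
  have hB' : ∀ i j, B i j = ∑ k, D k i * D k j := by
    intro i j
    have := congrFun (congrFun hD i) j
    simpa [Matrix.mul_apply, Matrix.star_eq_conjTranspose, Matrix.conjTranspose_apply] using this
  have : ∑ i, ∑ j, A i j * B i j = ∑ k, ∑ i, ∑ j, A i j * D k i * D k j := by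
    rw [Finset.sum_comm]
    conv_rhs => rw [Finset.sum_comm]
    rw [Finset.sum_comm]
    refine Finset.sum_congr rfl fun i _ => ?_
    rw [Finset.sum_comm]
    refine Finset.sum_congr rfl fun j _ => ?_
    rw [hB', Finset.mul_sum]
    exact Finset.sum_congr rfl fun k _ => by ring
  rw [this]
  exact Finset.sum_nonneg fun k _ => hA (D k)

/-! ### Second-order jets along lines -/

/-- `f` is differentiable near `0` and twice differentiable at `0`, with first and second derivative
`f₁` and `f₂` there. -/
def HasTwoJet (f : ℝ → ℝ) (f₁ f₂ : ℝ) : Prop :=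
  ∃ f' : ℝ → ℝ, (∀ᶠ s in 𝓝 0, HasDerivAt f (f' s) s) ∧ f' 0 = f₁ ∧ HasDerivAt f' f₂ 0

namespace HasTwoJet

variable {f g : ℝ → ℝ} {f₁ f₂ g₁ g₂ : ℝ}

theorem hasDerivAt (hf : HasTwoJet f f₁ f₂) : HasDerivAt f f₁ 0 := by
  obtain ⟨f', h, rfl, -⟩ := hf
  exact h.self_of_nhds

theorem sub (hf : HasTwoJet f f₁ f₂) (hg : HasTwoJet g g₁ g₂) :
    HasTwoJet (fun s => f s - g s) (f₁ - g₁) (f₂ - g₂) := by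
  obtain ⟨f', h, rfl, h2⟩ := hf
  obtain ⟨g', k, rfl, k2⟩ := hg
  refine ⟨fun s => f' s - g' s, ?_, rfl, h2.sub k2⟩
  filter_upwards [h, k] with s hs ks using hs.sub ks

theorem const_mul (c : ℝ) (hf : HasTwoJet f f₁ f₂) :
    HasTwoJet (fun s => c * f s) (c * f₁) (c * f₂) := by
  obtain ⟨f', h, rfl, h2⟩ := hf
  refine ⟨fun s => c * f' s, ?_, rfl, h2.const_mul c⟩
  filter_upwards [h] with s hs using hs.const_mul c

theorem mul (hf : HasTwoJet f f₁ f₂) (hg : HasTwoJet g g₁ g₂) :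
    HasTwoJet (fun s => f s * g s) (f₁ * g 0 + f 0 * g₁)
      (f₂ * g 0 + 2 * (f₁ * g₁) + f 0 * g₂) := by
  have hfd := hf.hasDerivAt
  have hgd := hg.hasDerivAt
  obtain ⟨f', h, rfl, h2⟩ := hf
  obtain ⟨g', k, rfl, k2⟩ := hg
  refine ⟨fun s => f' s * g s + f s * g' s, ?_, rfl, ?_⟩
  · filter_upwards [h, k] with s hs ks using hs.mul ks
  · exact ((h2.mul hgd).add (hfd.mul k2)).congr_deriv (by ring)

theorem rpow (hf : HasTwoJet f f₁ f₂) (h0 : 0 < f 0) (q : ℝ) :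
    HasTwoJet (fun s => f s ^ q) (q * f 0 ^ (q - 1) * f₁)
      (q * f 0 ^ (q - 1) * f₂ + q * (q - 1) * f 0 ^ (q - 2) * f₁ ^ 2) := by
  have hfd := hf.hasDerivAt
  obtain ⟨f', h, rfl, h2⟩ := hf
  refine ⟨fun s => q * f s ^ (q - 1) * f' s, ?_, rfl, ?_⟩
  · filter_upwards [h, hfd.continuousAt.eventually (lt_mem_nhds h0)] with s hs ks
    exact (hs.rpow_const (p := q) (Or.inl ks.ne')).congr_deriv (by ring)
  · have := (hfd.rpow_const (p := q - 1) (Or.inl h0.ne')).const_mul q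
    refine (this.mul h2).congr_deriv ?_
    have e : q - 1 - 1 = q - 2 := by ring
    rw [e]; ring

theorem quadratic (a b c : ℝ) : HasTwoJet (fun s => a + s * b + s ^ 2 * c) b (2 * c) := by
  refine ⟨fun s => b + 2 * s * c, Filter.Eventually.of_forall fun s => ?_, by simp, ?_⟩
  · have := (((hasDerivAt_id s).mul_const b).const_add a).add (((hasDerivAt_id s).pow 2).mul_const c)
    exact this.congr_deriv (by simp)
  · have := ((((hasDerivAt_id (0:ℝ)).const_mul 2).mul_const c)).const_add b
    exact this.congr_deriv (by simp)

/-- The second-derivative test, necessary part. -/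
theorem eq_zero_and_nonpos_of_isLocalMax (hf : HasTwoJet f f₁ f₂) (hm : IsLocalMax f 0) :
    f₁ = 0 ∧ f₂ ≤ 0 := by
  have h0 : f₁ = 0 := hm.hasDerivAt_eq_zero hf.hasDerivAt
  refine ⟨h0, ?_⟩
  by_contra! hpos
  have hfd := hf.hasDerivAt
  obtain ⟨f', h, rfl, h2⟩ := hf
  have hd : deriv f =ᶠ[𝓝 0] f' := by
    filter_upwards [h] with s hs using hs.deriv
  have hmin : IsLocalMin f 0 := by
    refine isLocalMin_of_deriv_deriv_pos ?_ ?_ hfd.continuousAt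
    · rw [(h2.congr_of_eventuallyEq hd).deriv]; exact hpos
    · rw [hfd.deriv, h0]
  -- A local maximum that is also a local minimum is locally constant, so its jet vanishes.
  have hc : f =ᶠ[𝓝 0] fun _ => f 0 := by
    filter_upwards [hm, hmin] with s hs ks using le_antisymm hs ks
  have hd0 : f' =ᶠ[𝓝 0] fun _ => 0 := by
    filter_upwards [hd, hc.deriv] with s hs ks
    rw [← hs, ks, deriv_const]
  have := (h2.congr_of_eventuallyEq hd0.symm).unique (hasDerivAt_const (0 : ℝ) (0 : ℝ))
  exact hpos.ne' this

end HasTwoJet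

theorem partialD2_eq {n : ℕ} {u : E n → ℝ} {x : E n} (hu : ContDiffAt ℝ 2 u x) (i j : Fin n) :
    partialD2 i j u x =
      fderiv ℝ (fderiv ℝ u) x (EuclideanSpace.single i 1) (EuclideanSpace.single j 1) := by
  have hd : DifferentiableAt ℝ (fderiv ℝ u) x :=
    (hu.fderiv_right (m := 1) (by norm_num)).differentiableAt (by norm_num)
  have : HasFDerivAt (fun y => fderiv ℝ u y (EuclideanSpace.single j 1))
      ((ContinuousLinearMap.apply ℝ ℝ (EuclideanSpace.single j (1:ℝ))).comp
        (fderiv ℝ (fderiv ℝ u) x)) x :=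
    (ContinuousLinearMap.apply ℝ ℝ (EuclideanSpace.single j (1:ℝ))).hasFDerivAt.comp x
      hd.hasFDerivAt
  unfold partialD2
  conv_lhs => unfold partialD
  rw [this.fderiv]
  simp

theorem partialD2_comm {n : ℕ} {u : E n → ℝ} {x : E n} (hu : ContDiffAt ℝ 2 u x) (i j : Fin n) :
    partialD2 i j u x = partialD2 j i u x := by
  rw [partialD2_eq hu, partialD2_eq hu]
  exact (hu.isSymmSndFDerivAt (by simp)).eq _ _

theorem sum_single {n : ℕ} (h : E n) : ∑ i, h i • EuclideanSpace.single i (1 : ℝ) = h := by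
  ext k
  simp [Pi.single_apply]

theorem map_eq_sum {n : ℕ} (L : E n →L[ℝ] ℝ) (h : E n) :
    L h = ∑ i, L (EuclideanSpace.single i 1) * h i := by
  conv_lhs => rw [← sum_single h, map_sum]
  exact Finset.sum_congr rfl fun i _ => by rw [map_smul, smul_eq_mul, mul_comm]

/-- Second-order expansion of `u` along the line through `x` in direction `h`. -/
theorem hasTwoJet_line {n : ℕ} {u : E n → ℝ} {x : E n} (hu : ContDiffAt ℝ 2 u x) (h : E n) :
    HasTwoJet (fun s : ℝ => u (x + s • h)) (fderiv ℝ u x h)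
      (∑ i, ∑ j, partialD2 i j u x * h i * h j) := by
  have hl : ∀ s : ℝ, HasDerivAt (fun s : ℝ => x + s • h) h s := fun s => by
    simpa using ((hasDerivAt_id s).smul_const h).const_add x
  have hl0 : Filter.Tendsto (fun s : ℝ => x + s • h) (𝓝 0) (𝓝 x) := by
    simpa using (hl 0).continuousAt.tendsto
  refine ⟨fun s => fderiv ℝ u (x + s • h) h, ?_, by simp, ?_⟩
  · have := hl0.eventually ((hu.of_le one_le_two).eventually (by simp))
    filter_upwards [this] with s hs
    exact (hs.differentiableAt one_ne_zero).hasFDerivAt.comp_hasDerivAt s (hl s)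
  · have hd : DifferentiableAt ℝ (fderiv ℝ u) x :=
      (hu.fderiv_right (m := 1) (by norm_num)).differentiableAt (by norm_num)
    have h1 : HasFDerivAt (fun y => fderiv ℝ u y h)
      ((ContinuousLinearMap.apply ℝ ℝ h).comp (fderiv ℝ (fderiv ℝ u) x)) (x + (0 : ℝ) • h) := by
      rw [zero_smul, add_zero]
      exact (ContinuousLinearMap.apply ℝ ℝ h).hasFDerivAt.comp x hd.hasFDerivAt
    have h2 := h1.comp_hasDerivAt (0 : ℝ) (hl 0)
    refine h2.congr_deriv ?_
    simp only [ContinuousLinearMap.comp_apply, ContinuousLinearMap.apply_apply]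
    have e1 := map_eq_sum ((ContinuousLinearMap.apply ℝ ℝ h).comp (fderiv ℝ (fderiv ℝ u) x)) h
    simp only [ContinuousLinearMap.comp_apply, ContinuousLinearMap.apply_apply] at e1
    rw [e1]
    refine Finset.sum_congr rfl fun i _ => ?_
    rw [map_eq_sum (fderiv ℝ (fderiv ℝ u) x (EuclideanSpace.single i 1)) h, Finset.sum_mul]
    refine Finset.sum_congr rfl fun j _ => ?_
    rw [partialD2_eq hu]; ring

/-! ### Stability of convexity -/

theorem map_sum_le_of_approx_convex {n : ℕ} {Ω : Set (E n)} (hΩ : Convex ℝ Ω) {v : E n → ℝ}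
    {δ : ℝ} (hδ : 0 ≤ δ)
    (hv : ∀ x ∈ Ω, ∀ y ∈ Ω, ∀ t ∈ Set.Icc (0 : ℝ) 1,
      v (t • y + (1 - t) • x) ≤ t * v y + (1 - t) * v x + δ)
    {ι : Type*} (s : Finset ι) (z : ι → E n) (w : ι → ℝ) (hz : ∀ i ∈ s, z i ∈ Ω)
    (hw : ∀ i ∈ s, 0 ≤ w i) (hs : ∑ i ∈ s, w i = 1) :
    v (∑ i ∈ s, w i • z i) ≤ ∑ i ∈ s, w i * v (z i) + s.card * δ := by
  classical
  induction s using Finset.induction_on generalizing w with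
  | empty => simp at hs
  | insert i s hi ih =>
    rw [Finset.sum_insert hi] at hs ⊢
    rw [Finset.sum_insert hi, Finset.card_insert_of_notMem hi]
    have hws : ∀ j ∈ s, 0 ≤ w j := fun j hj => hw j (Finset.mem_insert_of_mem hj)
    have hzs : ∀ j ∈ s, z j ∈ Ω := fun j hj => hz j (Finset.mem_insert_of_mem hj)
    have hwi := hw i (Finset.mem_insert_self i s)
    have hW0 : 0 ≤ ∑ j ∈ s, w j := Finset.sum_nonneg hws
    set W := ∑ j ∈ s, w j with hW
    rcases hW0.eq_or_lt with h0 | hpos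
    · have hz0 : ∀ j ∈ s, w j = 0 := (Finset.sum_eq_zero_iff_of_nonneg hws).mp h0.symm
      have e1 : ∑ j ∈ s, w j • z j = 0 :=
        Finset.sum_eq_zero fun j hj => by rw [hz0 j hj, zero_smul]
      have e2 : ∑ j ∈ s, w j * v (z j) = 0 :=
        Finset.sum_eq_zero fun j hj => by rw [hz0 j hj, zero_mul]
      have e3 : w i = 1 := by linarith
      rw [e1, e2, e3]
      simp only [one_smul, add_zero, one_mul]
      have : 0 ≤ ((s.card + 1 : ℕ) : ℝ) * δ := by positivity
      linarith
    · have hs' : ∑ j ∈ s, w j / W = 1 := by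
        rw [← Finset.sum_div, ← hW, div_self hpos.ne']
      have hw' : ∀ j ∈ s, 0 ≤ w j / W := fun j hj => div_nonneg (hws j hj) hpos.le
      have h1 := ih (fun j => w j / W) hzs hw' hs'
      have hmem : ∑ j ∈ s, (w j / W) • z j ∈ Ω := hΩ.sum_mem hw' hs' hzs
      have h2 := hv _ hmem _ (hz i (Finset.mem_insert_self i s)) (w i) ⟨hwi, by linarith⟩
      have hWi : 1 - w i = W := by linarith
      rw [hWi] at h2
      have e1 : W • ∑ j ∈ s, (w j / W) • z j = ∑ j ∈ s, w j • z j := by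
        rw [Finset.smul_sum]
        refine Finset.sum_congr rfl fun j _ => ?_
        rw [smul_smul, mul_div_cancel₀ _ hpos.ne']
      have e2 : W * ∑ j ∈ s, (w j / W) * v (z j) = ∑ j ∈ s, w j * v (z j) := by
        rw [Finset.mul_sum]
        refine Finset.sum_congr rfl fun j _ => ?_
        rw [← mul_assoc, mul_div_cancel₀ _ hpos.ne']
      rw [e1] at h2
      have h3 := mul_le_mul_of_nonneg_left h1 hpos.le
      rw [mul_add, e2] at h3
      have h4 : W * (s.card * δ) ≤ s.card * δ :=
        mul_le_of_le_one_left (by positivity) (by linarith)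
      push_cast
      linarith

/-- Hyers–Ulam stability of convexity: `h` is the convex envelope of `v`, and by Carathéodory's
theorem its values involve convex combinations of at most `n + 2` points of the epigraph. -/
theorem exists_convexOn_near_of_approx_convex {n : ℕ} {Ω : Set (E n)} (hΩ : Convex ℝ Ω)
    {v : E n → ℝ} {δ : ℝ} (hδ : 0 ≤ δ)
    (hv : ∀ x ∈ Ω, ∀ y ∈ Ω, ∀ t ∈ Set.Icc (0 : ℝ) 1,
      v (t • y + (1 - t) • x) ≤ t * v y + (1 - t) * v x + δ) :
    ∃ h : E n → ℝ, ConvexOn ℝ Ω h ∧ ∀ x ∈ Ω, |v x - h x| ≤ (n + 2) * δ := by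
  set S : Set (E n × ℝ) := {q | q.1 ∈ Ω ∧ v q.1 ≤ q.2} with hS
  have hbelow : ∀ q ∈ convexHull ℝ S, v q.1 - (n + 2) * δ ≤ q.2 := by
    intro q hq
    obtain ⟨ι, hι, z, w, hzS, hind, hw, hs, rfl⟩ := eq_pos_convex_span_of_mem_convexHull hq
    have hz : ∀ i, (z i).1 ∈ Ω ∧ v (z i).1 ≤ (z i).2 := fun i => hzS ⟨i, rfl⟩
    have hcard : (Fintype.card ι : ℝ) ≤ n + 2 := by
      have h1 := hind.card_le_finrank_succ
      have h2 := Submodule.finrank_le (vectorSpan ℝ (Set.range z))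
      rw [Module.finrank_prod, finrank_euclideanSpace_fin, Module.finrank_self] at h2
      have : Fintype.card ι ≤ n + 2 := by omega
      exact_mod_cast this
    have h1 := map_sum_le_of_approx_convex hΩ hδ hv Finset.univ (fun i => (z i).1) w
      (fun i _ => (hz i).1) (fun i _ => (hw i).le) hs
    have h2 : ∑ i, w i * v (z i).1 ≤ ∑ i, w i * (z i).2 :=
      Finset.sum_le_sum fun i _ => mul_le_mul_of_nonneg_left (hz i).2 (hw i).le
    have h3 : (Fintype.card ι : ℝ) * δ ≤ (n + 2) * δ := mul_le_mul_of_nonneg_right hcard hδ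
    rw [Prod.fst_sum, Prod.snd_sum]
    simp only [Prod.smul_fst, Prod.smul_snd, smul_eq_mul]
    rw [Finset.card_univ] at h1
    linarith
  have hsub : ∀ x ∈ Ω, (x, v x) ∈ convexHull ℝ S := fun x hx =>
    subset_convexHull ℝ S ⟨hx, le_rfl⟩
  have hbdd : ∀ x, BddBelow {y | (x, y) ∈ convexHull ℝ S} := fun x =>
    ⟨v x - (n + 2) * δ, fun y hy => hbelow (x, y) hy⟩
  refine ⟨fun x => sInf {y | (x, y) ∈ convexHull ℝ S}, ⟨hΩ, ?_⟩, ?_⟩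
  · intro x hx y hy a b ha hb hab
    refine le_of_forall_pos_le_add fun η hη => ?_
    obtain ⟨p, hp, hpl⟩ := exists_lt_of_csInf_lt (s := {z | (x, z) ∈ convexHull ℝ S})
      ⟨_, hsub x hx⟩ (lt_add_of_pos_right _ hη)
    obtain ⟨q, hq, hql⟩ := exists_lt_of_csInf_lt (s := {z | (y, z) ∈ convexHull ℝ S})
      ⟨_, hsub y hy⟩ (lt_add_of_pos_right _ hη)
    have hmem : (a • x + b • y, a * p + b * q) ∈ convexHull ℝ S := by
      simpa using convex_convexHull ℝ S hp hq ha hb hab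
    have h1 := csInf_le (hbdd (a • x + b • y)) hmem
    have h2 := mul_le_mul_of_nonneg_left hpl.le ha
    have h3 := mul_le_mul_of_nonneg_left hql.le hb
    have h4 : η = a * η + b * η := by rw [← add_mul, hab, one_mul]
    simp only [smul_eq_mul]
    linarith
  · intro x hx
    have h1 := csInf_le (hbdd x) (hsub x hx)
    have h2 : v x - (n + 2) * δ ≤ sInf {y | (x, y) ∈ convexHull ℝ S} :=
      le_csInf ⟨_, hsub x hx⟩ fun y hy => hbelow (x, y) hy
    have h3 : 0 ≤ (n + 2 : ℝ) * δ := by positivity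
    rw [abs_le]
    constructor <;> linarith

/-! ### Interior sets and Lipschitz bounds -/

theorem ball_subset_of_mem_innerSet {n : ℕ} {Ω : Set (E n)} {ρ : ℝ} {x : E n}
    (hx : x ∈ innerSet Ω ρ) : Metric.ball x ρ ⊆ Ω := by
  intro y hy
  by_contra hyΩ
  obtain ⟨z, hzf, hz⟩ := exists_mem_frontier_infDist_compl_eq_dist hx.1
    (fun h => hyΩ (h ▸ Set.mem_univ y))
  have h1 := hx.2.trans (Metric.infDist_le_dist_of_mem hzf)
  have h2 := Metric.infDist_le_dist_of_mem (x := x) (Set.mem_compl hyΩ)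
  rw [Metric.mem_ball, dist_comm] at hy
  linarith

theorem combo_mem_innerSet {n : ℕ} {Ω : Set (E n)} (ho : IsOpen Ω) (hc : Convex ℝ Ω) {ρ : ℝ}
    (hρ : 0 < ρ) {x y : E n} (hx : x ∈ innerSet Ω ρ) (hy : y ∈ innerSet Ω ρ) {t : ℝ}
    (ht : t ∈ Set.Icc (0 : ℝ) 1) : t • y + (1 - t) • x ∈ innerSet Ω ρ := by
  have hne : (frontier Ω).Nonempty := by
    by_contra h
    rw [Set.not_nonempty_iff_eq_empty] at h
    have := hx.2
    rw [h, Metric.infDist_empty] at this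
    linarith
  have h0 : (0 : ℝ) ≤ 1 - t := by linarith [ht.2]
  refine ⟨hc hy.1 hx.1 ht.1 h0 (by ring), (Metric.le_infDist hne).mpr fun z hz => ?_⟩
  by_contra! hlt
  rw [dist_comm, dist_eq_norm] at hlt
  set e := z - (t • y + (1 - t) • x) with he
  have hxe : x + e ∈ Ω := ball_subset_of_mem_innerSet hx (by simpa using hlt)
  have hye : y + e ∈ Ω := ball_subset_of_mem_innerSet hy (by simpa using hlt)
  have hzΩ : z ∈ Ω := by
    convert hc hye hxe ht.1 h0 (by ring) using 1
    rw [smul_add, smul_add, sub_smul (1 : ℝ) t e, he]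
    module
  rw [ho.frontier_eq] at hz
  exact hz.2 hzΩ

theorem isCompact_innerSet {n : ℕ} {Ω : Set (E n)} (ho : IsOpen Ω)
    (hb : Bornology.IsBounded Ω) {ρ : ℝ} (hρ : 0 < ρ) : IsCompact (innerSet Ω ρ) := by
  have : innerSet Ω ρ = closure Ω ∩ {x | ρ ≤ Metric.infDist x (frontier Ω)} := by
    ext x
    refine ⟨fun h => ⟨subset_closure h.1, h.2⟩, fun h => ⟨?_, h.2⟩⟩
    by_contra hx
    have hf : x ∈ frontier Ω := by rw [ho.frontier_eq]; exact ⟨h.1, hx⟩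
    have h2 : ρ ≤ Metric.infDist x (frontier Ω) := h.2
    rw [Metric.infDist_zero_of_mem hf] at h2
    linarith
  refine Metric.isCompact_of_isClosed_isBounded ?_ (hb.subset fun x hx => hx.1)
  rw [this]
  exact isClosed_closure.inter
    (isClosed_le continuous_const (Metric.continuous_infDist_pt _))

theorem exists_pos_mem_innerSet {n : ℕ} {Ω : Set (E n)} (ho : IsOpen Ω)
    (hne : (frontier Ω).Nonempty) {x y : E n} (hx : x ∈ Ω) (hy : y ∈ Ω) :
    ∃ ρ : ℝ, 0 < ρ ∧ x ∈ innerSet Ω ρ ∧ y ∈ innerSet Ω ρ := by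
  have key : ∀ z ∈ Ω, 0 < Metric.infDist z (frontier Ω) := by
    intro z hz
    refine (isClosed_frontier.notMem_iff_infDist_pos hne).mp fun hf => ?_
    rw [ho.frontier_eq] at hf
    exact hf.2 hz
  exact ⟨_, lt_min (key x hx) (key y hy), ⟨hx, min_le_left _ _⟩, hy, min_le_right _ _⟩

theorem norm_le_of_eLpNorm_top_lt {n : ℕ} {Ω : Set (E n)} (ho : IsOpen Ω) {g : E n → E n}
    (hg : ContinuousOn g Ω) {ε : ℝ}
    (h : MeasureTheory.eLpNorm g ∞ (MeasureTheory.volume.restrict Ω) < ENNReal.ofReal ε)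
    {x : E n} (hx : x ∈ Ω) : ‖g x‖ ≤ ε := by
  have hε : 0 < ε := ENNReal.ofReal_pos.mp (bot_le.trans_lt h)
  by_contra! hlt
  have hU : IsOpen (Ω ∩ {y | ε < ‖g y‖}) :=
    hg.norm.isOpen_inter_preimage ho isOpen_Ioi
  have hae := MeasureTheory.enorm_ae_le_eLpNormEssSup g (MeasureTheory.volume.restrict Ω)
  rw [MeasureTheory.ae_restrict_iff' ho.measurableSet] at hae
  rw [MeasureTheory.eLpNorm_exponent_top] at h
  have hz : MeasureTheory.volume (Ω ∩ {y | ε < ‖g y‖}) = 0 := by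
    refine MeasureTheory.measure_mono_null (fun y hy => ?_) (MeasureTheory.ae_iff.mp hae)
    intro hcon
    have h1 := (hcon hy.1).trans_lt h
    rw [← ofReal_norm, ENNReal.ofReal_lt_ofReal_iff hε] at h1
    exact lt_asymm h1 hy.2
  exact Set.notMem_empty x (((hU.measure_eq_zero_iff _).mp hz) ▸ ⟨hx, hlt⟩)

theorem abs_sub_le_of_eLpNorm_gradient_lt {n : ℕ} {Ω : Set (E n)} (ho : IsOpen Ω)
    (hc : Convex ℝ Ω) {f : E n → ℝ} (hf : ContDiffOn ℝ 1 f Ω) {ε : ℝ}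
    (h : MeasureTheory.eLpNorm (gradient f) ∞ (MeasureTheory.volume.restrict Ω) <
      ENNReal.ofReal ε)
    {x y : E n} (hx : x ∈ Ω) (hy : y ∈ Ω) : |f x - f y| ≤ ε * dist x y := by
  have hg : ContinuousOn (gradient f) Ω :=
    ((InnerProductSpace.toDual ℝ (E n)).symm.continuous.comp_continuousOn
      (hf.continuousOn_fderiv_of_isOpen ho le_rfl))
  have hd : ∀ z ∈ Ω, DifferentiableAt ℝ f z := fun z hz =>
    (hf.contDiffAt (ho.mem_nhds hz)).differentiableAt one_ne_zero
  have hb : ∀ z ∈ Ω, ‖fderiv ℝ f z‖ ≤ ε := fun z hz => by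
    have := norm_le_of_eLpNorm_top_lt ho hg h hz
    rwa [gradient, LinearIsometryEquiv.norm_map] at this
  have := hc.norm_image_sub_le_of_norm_fderiv_le hd hb hy hx
  rwa [Real.norm_eq_abs, ← dist_eq_norm] at this

theorem abs_a_sub_le {n : ℕ} {Ω : Set (E n)} (ho : IsOpen Ω) (hc : Convex ℝ Ω) {β : ℝ}
    {a : E n → ℝ} {α : Fin n → Fin n → E n → ℝ} {u : E n → ℝ} (hu : IsSolution Ω β a α u)
    {ε : ℝ} (hε : variation Ω a α < ENNReal.ofReal ε) {x y : E n} (hx : x ∈ Ω) (hy : y ∈ Ω) :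
    |a x - a y| ≤ ε * dist x y :=
  abs_sub_le_of_eLpNorm_gradient_lt ho hc hu.a_C1 (lt_of_le_of_lt le_self_add hε) hx hy

theorem abs_α_sub_le {n : ℕ} {Ω : Set (E n)} (ho : IsOpen Ω) (hc : Convex ℝ Ω) {β : ℝ}
    {a : E n → ℝ} {α : Fin n → Fin n → E n → ℝ} {u : E n → ℝ} (hu : IsSolution Ω β a α u)
    {ε : ℝ} (hε : variation Ω a α < ENNReal.ofReal ε) {x y : E n} (hx : x ∈ Ω) (hy : y ∈ Ω)
    (i j : Fin n) : |α i j x - α i j y| ≤ ε * dist x y := by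
  refine abs_sub_le_of_eLpNorm_gradient_lt ho hc (hu.α_C1 i j) (lt_of_le_of_lt ?_ hε) hx hy
  refine le_trans ?_ le_add_self
  exact le_trans (le_iSup (fun j => MeasureTheory.eLpNorm (gradient (α i j)) ∞
    (MeasureTheory.volume.restrict Ω)) j) (le_iSup (fun i => ⨆ j,
      MeasureTheory.eLpNorm (gradient (α i j)) ∞ (MeasureTheory.volume.restrict Ω)) i)

/-! ### Conditions at an interior maximum of the concavity function -/

/-- The gradient of `v = -u^γ` in coordinates. -/
noncomputable def gradPow {n : ℕ} (γ : ℝ) (u : E n → ℝ) (x : E n) (i : Fin n) : ℝ :=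
  -(γ * u x ^ (γ - 1) * partialD i u x)

/-- The Hessian matrix of `v = -u^γ`, written in terms of the derivatives of `u`. -/
noncomputable def hessPow {n : ℕ} (γ : ℝ) (u : E n → ℝ) (x : E n) (i j : Fin n) : ℝ :=
  -(γ * u x ^ (γ - 1) * partialD2 i j u x +
    γ * (γ - 1) * u x ^ (γ - 2) * (partialD i u x * partialD j u x))

/-- The numerator in the equation `∑ α^{ij} D²_{ij} v = B / (-v)` satisfied by `v = -u^γ`,
`γ = (1 - β) / 2`; it depends on `v` only through the gradient `p` of `v`. -/
noncomputable def source {n : ℕ} (γ : ℝ) (a : E n → ℝ) (α : Fin n → Fin n → E n → ℝ) (p : Fin n → ℝ)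
    (x : E n) : ℝ :=
  (1 / γ - 1) * ∑ i, ∑ j, α i j x * p i * p j + γ * a x

theorem hasTwoJet_neg_rpow_line {n : ℕ} {u : E n → ℝ} {x : E n} (hu : ContDiffAt ℝ 2 u x)
    (h0 : 0 < u x) (γ : ℝ) (h : E n) :
    HasTwoJet (fun s : ℝ => -(u (x + s • h) ^ γ)) (∑ i, gradPow γ u x i * h i)
      (∑ i, ∑ j, hessPow γ u x i j * h i * h j) := by
  have h1 := ((hasTwoJet_line hu h).rpow (by simpa using h0) γ).const_mul (-1)
  simp only [zero_smul, add_zero, neg_one_mul] at h1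
  have e : fderiv ℝ u x h = ∑ i, partialD i u x * h i := map_eq_sum _ h
  convert h1 using 1
  · rw [e, Finset.mul_sum, ← Finset.sum_neg_distrib]
    exact Finset.sum_congr rfl fun i _ => by rw [gradPow]; ring
  · rw [e, sq, Finset.sum_mul_sum, Finset.mul_sum, Finset.mul_sum, ← Finset.sum_add_distrib,
      ← Finset.sum_neg_distrib]
    refine Finset.sum_congr rfl fun i _ => ?_
    rw [Finset.mul_sum, Finset.mul_sum, ← Finset.sum_add_distrib, ← Finset.sum_neg_distrib]
    exact Finset.sum_congr rfl fun j _ => by rw [hessPow]; ring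

theorem sum_mul_hessPow {n : ℕ} {Ω : Set (E n)} {β : ℝ} (hβ₁ : β < 1)
    {a : E n → ℝ} {α : Fin n → Fin n → E n → ℝ} {u : E n → ℝ} (hu : IsSolution Ω β a α u)
    {x : E n} (hx : x ∈ Ω) :
    ∑ i, ∑ j, α i j x * hessPow ((1 - β) / 2) u x i j =
      source ((1 - β) / 2) a α (gradPow ((1 - β) / 2) u x) x / u x ^ ((1 - β) / 2) := by
  set γ := (1 - β) / 2 with hγ
  have hγ0 : 0 < γ := by rw [hγ]; linarith
  have hβ : β = 1 - 2 * γ := by rw [hγ]; ring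
  have h0 := hu.u_pos x hx
  have heq := hu.equation x hx
  have e1 : ∑ i, ∑ j, α i j x * hessPow γ u x i j =
      γ * u x ^ (γ - 1) * -(∑ i, ∑ j, α i j x * partialD2 i j u x) +
      γ * (1 - γ) * u x ^ (γ - 2) *
        ∑ i, ∑ j, α i j x * partialD i u x * partialD j u x := by
    rw [← Finset.sum_neg_distrib, Finset.mul_sum, Finset.mul_sum, ← Finset.sum_add_distrib]
    refine Finset.sum_congr rfl fun i _ => ?_
    rw [← Finset.sum_neg_distrib, Finset.mul_sum, Finset.mul_sum, ← Finset.sum_add_distrib]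
    exact Finset.sum_congr rfl fun j _ => by rw [hessPow]; ring
  have e2 : ∑ i, ∑ j, α i j x * gradPow γ u x i * gradPow γ u x j =
      γ ^ 2 * (u x ^ (γ - 1)) ^ 2 *
        ∑ i, ∑ j, α i j x * partialD i u x * partialD j u x := by
    rw [Finset.mul_sum]
    refine Finset.sum_congr rfl fun i _ => ?_
    rw [Finset.mul_sum]
    exact Finset.sum_congr rfl fun j _ => by rw [gradPow, gradPow]; ring
  have p1 : u x ^ (γ - 1) * u x ^ β * u x ^ γ = 1 := by
    rw [← Real.rpow_add h0, ← Real.rpow_add h0, hβ]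
    convert Real.rpow_zero _ using 2
    ring
  have p2 : (u x ^ (γ - 1)) ^ 2 = u x ^ (γ - 2) * u x ^ γ := by
    rw [sq, ← Real.rpow_add h0, ← Real.rpow_add h0]
    congr 1; ring
  rw [eq_div_iff (Real.rpow_pos_of_pos h0 γ).ne', e1, heq, source, e2, p2]
  have : γ * u x ^ (γ - 1) * (a x * u x ^ β) * u x ^ γ = γ * a x := by
    linear_combination γ * a x * p1
  rw [add_mul, this]
  field_simp
  ring

/-- First- and second-order conditions at a maximum of the concavity function over pairs of interior
points; the points `x₁`, `x₃` are moved along independent directions `h₁`, `h₃`. -/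
theorem conditions_at_max {n : ℕ} {Ω : Set (E n)} (ho : IsOpen Ω) (hc : Convex ℝ Ω) {γ : ℝ}
    {u : E n → ℝ} (hu : ContDiffOn ℝ 2 u Ω) (h0 : ∀ x ∈ Ω, 0 < u x) {x₁ x₃ : E n} {t : ℝ}
    (h₁ : x₁ ∈ Ω) (h₃ : x₃ ∈ Ω) (ht : t ∈ Set.Icc (0 : ℝ) 1)
    (hmax : IsMaxOn (concavityFn fun x => -(u x ^ γ)) (triples Ω) (x₁, x₃, t)) (k₁ k₃ : E n) :
    (∑ i, gradPow γ u (t • x₃ + (1 - t) • x₁) i * (t • k₃ + (1 - t) • k₁) i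
        - t * ∑ i, gradPow γ u x₃ i * k₃ i - (1 - t) * ∑ i, gradPow γ u x₁ i * k₁ i = 0) ∧
      ∑ i, ∑ j, hessPow γ u (t • x₃ + (1 - t) • x₁) i j * (t • k₃ + (1 - t) • k₁) i *
          (t • k₃ + (1 - t) • k₁) j
        - t * ∑ i, ∑ j, hessPow γ u x₃ i j * k₃ i * k₃ j
        - (1 - t) * ∑ i, ∑ j, hessPow γ u x₁ i j * k₁ i * k₁ j ≤ 0 := by
  have h₂ : t • x₃ + (1 - t) • x₁ ∈ Ω :=
    hc h₃ h₁ ht.1 (by linarith [ht.2]) (by ring)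
  have jet : ∀ x ∈ Ω, ∀ k : E n, HasTwoJet (fun s : ℝ => -(u (x + s • k) ^ γ))
      (∑ i, gradPow γ u x i * k i) (∑ i, ∑ j, hessPow γ u x i j * k i * k j) :=
    fun x hx k => hasTwoJet_neg_rpow_line (hu.contDiffAt (ho.mem_nhds hx)) (h0 x hx) γ k
  refine (((jet _ h₂ (t • k₃ + (1 - t) • k₁)).sub ((jet _ h₃ k₃).const_mul t)).sub
    ((jet _ h₁ k₁).const_mul (1 - t))).eq_zero_and_nonpos_of_isLocalMax ?_
  have hmem : ∀ x ∈ Ω, ∀ k : E n, ∀ᶠ s : ℝ in 𝓝 0, x + s • k ∈ Ω := by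
    intro x hx k
    have : Continuous fun s : ℝ => x + s • k := by fun_prop
    exact this.continuousAt.eventually (ho.mem_nhds (by simpa using hx))
  filter_upwards [hmem x₁ h₁ k₁, hmem x₃ h₃ k₃] with s hs₁ hs₃
  have h := hmax (show (x₁ + s • k₁, x₃ + s • k₃, t) ∈ triples Ω from
    ⟨subset_closure hs₁, subset_closure hs₃, ht⟩)
  simp only [concavityFn, Set.mem_ofPred_eq] at h
  have e : t • (x₃ + s • k₃) + (1 - t) • (x₁ + s • k₁) =
      t • x₃ + (1 - t) • x₁ + s • (t • k₃ + (1 - t) • k₁) := by module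
  rw [e] at h
  simpa using h

theorem gradPow_eq_at_max {n : ℕ} {Ω : Set (E n)} (ho : IsOpen Ω) (hc : Convex ℝ Ω) {γ : ℝ}
    {u : E n → ℝ} (hu : ContDiffOn ℝ 2 u Ω) (h0 : ∀ x ∈ Ω, 0 < u x) {x₁ x₃ : E n} {t : ℝ}
    (h₁ : x₁ ∈ Ω) (h₃ : x₃ ∈ Ω) (ht : t ∈ Set.Ioo (0 : ℝ) 1)
    (hmax : IsMaxOn (concavityFn fun x => -(u x ^ γ)) (triples Ω) (x₁, x₃, t)) :
    gradPow γ u x₁ = gradPow γ u (t • x₃ + (1 - t) • x₁) ∧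
      gradPow γ u x₃ = gradPow γ u (t • x₃ + (1 - t) • x₁) := by
  have key := fun k₁ k₃ =>
    (conditions_at_max ho hc hu h0 h₁ h₃ ⟨ht.1.le, ht.2.le⟩ hmax k₁ k₃).1
  have ht' : 1 - t ≠ 0 := by linarith [ht.2]
  constructor
  · ext i
    have := key (EuclideanSpace.single i 1) 0
    simp at this
    have h2 : (1 - t) * (gradPow γ u x₁ i - gradPow γ u (t • x₃ + (1 - t) • x₁) i) = 0 := by
      linear_combination -this
    exact sub_eq_zero.mp ((mul_eq_zero.mp h2).resolve_left ht')
  · ext i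
    have := key 0 (EuclideanSpace.single i 1)
    simp at this
    have h2 : t * (gradPow γ u x₃ i - gradPow γ u (t • x₃ + (1 - t) • x₁) i) = 0 := by
      linear_combination -this
    exact sub_eq_zero.mp ((mul_eq_zero.mp h2).resolve_left ht.1.ne')

/-- The matrix `m₂² D²v(x₂) - t m₃² D²v(x₃) - (1 - t) m₁² D²v(x₁)`, `m₂ = t m₃ + (1 - t) m₁`, is
negative semidefinite at a maximum of the concavity function, so its trace against the elliptic
matrix `(α^{ij}(x₂))` is nonpositive. -/
theorem trace_le_at_max {n : ℕ} {Ω : Set (E n)} (ho : IsOpen Ω) (hc : Convex ℝ Ω) {γ : ℝ}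
    {u : E n → ℝ} (hu : ContDiffOn ℝ 2 u Ω) (h0 : ∀ x ∈ Ω, 0 < u x) {x₁ x₃ : E n} {t : ℝ}
    (h₁ : x₁ ∈ Ω) (h₃ : x₃ ∈ Ω) (ht : t ∈ Set.Icc (0 : ℝ) 1)
    (hmax : IsMaxOn (concavityFn fun x => -(u x ^ γ)) (triples Ω) (x₁, x₃, t))
    (A : Fin n → Fin n → ℝ) (hA : ∀ p : Fin n → ℝ, 0 ≤ ∑ i, ∑ j, A i j * p i * p j)
    (m₁ m₃ : ℝ) :
    (t * m₃ + (1 - t) * m₁) ^ 2 *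
        ∑ i, ∑ j, A i j * hessPow γ u (t • x₃ + (1 - t) • x₁) i j ≤
      t * m₃ ^ 2 * (∑ i, ∑ j, A i j * hessPow γ u x₃ i j) +
        (1 - t) * m₁ ^ 2 * ∑ i, ∑ j, A i j * hessPow γ u x₁ i j := by
  have h₂ : t • x₃ + (1 - t) • x₁ ∈ Ω := hc h₃ h₁ ht.1 (by linarith [ht.2]) (by ring)
  set x₂ := t • x₃ + (1 - t) • x₁ with hx₂
  set m₂ := t * m₃ + (1 - t) * m₁ with hm₂
  have hsymm : ∀ x ∈ Ω, ∀ i j, hessPow γ u x i j = hessPow γ u x j i := by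
    intro x hx i j
    rw [hessPow, hessPow, partialD2_comm (hu.contDiffAt (ho.mem_nhds hx)) i j,
      mul_comm (partialD i u x)]
  have h := sum_mul_nonneg_of_quadratic_nonneg A
    (fun i j => t * m₃ ^ 2 * hessPow γ u x₃ i j + (1 - t) * m₁ ^ 2 * hessPow γ u x₁ i j
      - m₂ ^ 2 * hessPow γ u x₂ i j) hA
    (fun i j => by
      simp only [hsymm x₁ h₁ i j, hsymm x₂ h₂ i j, hsymm x₃ h₃ i j])
    (fun p => by
      have h2 := (conditions_at_max ho hc hu h0 h₁ h₃ ht hmax (m₁ • WithLp.toLp 2 p)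
        (m₃ • WithLp.toLp 2 p)).2
      have e : ∀ i, (t • m₃ • (WithLp.toLp 2 p : E n) + (1 - t) • m₁ • (WithLp.toLp 2 p : E n)) i
          = m₂ * p i := fun i => by
        simp [hm₂]; ring
      simp only [e, PiLp.smul_apply, smul_eq_mul, ← hx₂] at h2
      refine (neg_nonneg.mpr h2).trans_eq ?_
      simp only [Finset.mul_sum, ← Finset.sum_sub_distrib, ← Finset.sum_neg_distrib]
      exact Finset.sum_congr rfl fun i _ => Finset.sum_congr rfl fun j _ => by ring)
  rw [← sub_nonneg]
  refine h.trans_eq ?_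
  simp only [Finset.mul_sum, ← Finset.sum_sub_distrib, ← Finset.sum_add_distrib]
  exact Finset.sum_congr rfl fun i _ => Finset.sum_congr rfl fun j _ => by ring

theorem abs_sum_sum_mul_le {n : ℕ} (A B : Fin n → Fin n → ℝ) {c d : ℝ}
    (hA : ∀ i j, |A i j| ≤ c) (hB : ∀ i j, |B i j| ≤ d) :
    |∑ i, ∑ j, A i j * B i j| ≤ n ^ 2 * (c * d) := by
  calc |∑ i, ∑ j, A i j * B i j| ≤ ∑ i, ∑ j, |A i j * B i j| :=
        (Finset.abs_sum_le_sum_abs _ _).trans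
          (Finset.sum_le_sum fun i _ => Finset.abs_sum_le_sum_abs _ _)
    _ ≤ ∑ _i : Fin n, ∑ _j : Fin n, c * d := by
        refine Finset.sum_le_sum fun i _ => Finset.sum_le_sum fun j _ => ?_
        rw [abs_mul]
        exact mul_le_mul (hA i j) (hB i j) (abs_nonneg _) ((abs_nonneg _).trans (hA i j))
    _ = n ^ 2 * (c * d) := by simp; ring

theorem rpow_bounds {K s : ℝ} (hK : 1 ≤ K) (h1 : K⁻¹ ≤ s) (h2 : s ≤ K) {q : ℝ} {m : ℕ}
    (hq1 : -m ≤ q) (hq2 : q ≤ m) : s ^ q ≤ K ^ m := by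
  have hK0 : 0 < K := by linarith
  have hs : 0 < s := (inv_pos.mpr hK0).trans_le h1
  rw [← Real.rpow_natCast]
  rcases le_total 0 q with h | h
  · exact (Real.rpow_le_rpow hs.le h2 h).trans (Real.rpow_le_rpow_of_exponent_le hK hq2)
  · refine (Real.rpow_le_rpow_of_nonpos (inv_pos.mpr hK0) h1 h).trans ?_
    rw [Real.inv_rpow hK0.le, ← Real.rpow_neg hK0.le]
    exact Real.rpow_le_rpow_of_exponent_le hK (by linarith)

theorem abs_partialD_le {n : ℕ} (u : E n → ℝ) (x : E n) (i : Fin n) :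
    |partialD i u x| ≤ ‖gradient u x‖ := by
  have h := (fderiv ℝ u x).le_opNorm (EuclideanSpace.single i (1 : ℝ))
  rw [gradient, LinearIsometryEquiv.norm_map]
  simpa [partialD] using h

theorem abs_gradPow_le {n : ℕ} {u : E n → ℝ} {x : E n} {K γ : ℝ} (hK : 1 ≤ K) (hγ0 : 0 < γ)
    (hγ1 : γ ≤ 1) (h1 : K⁻¹ ≤ u x) (h2 : u x ≤ K) (hD : ‖gradient u x‖ ≤ K) (i : Fin n) :
    |gradPow γ u x i| ≤ K ^ 2 := by
  have hu0 : 0 < u x := (inv_pos.mpr (by linarith)).trans_le h1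
  have hp := rpow_bounds hK h1 h2 (q := γ - 1) (m := 1) (by push_cast; linarith)
    (by push_cast; linarith)
  have hd := (abs_partialD_le u x i).trans hD
  have hr := Real.rpow_pos_of_pos hu0 (γ - 1)
  rw [gradPow, abs_neg, abs_mul, abs_mul, abs_of_pos hγ0, abs_of_pos hr]
  calc γ * u x ^ (γ - 1) * |partialD i u x| ≤ 1 * K ^ 1 * K := by gcongr
    _ = K ^ 2 := by ring

theorem abs_hessPow_le {n : ℕ} {u : E n → ℝ} {x : E n} {K γ : ℝ} (hK : 1 ≤ K) (hγ0 : 0 < γ)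
    (hγ1 : γ ≤ 1) (h1 : K⁻¹ ≤ u x) (h2 : u x ≤ K) (hD : ‖gradient u x‖ ≤ K) {i j : Fin n}
    (hD2 : |partialD2 i j u x| ≤ K) :
    |hessPow γ u x i j| ≤ 2 * K ^ 4 := by
  have hu0 : 0 < u x := (inv_pos.mpr (by linarith)).trans_le h1
  have hp := rpow_bounds hK h1 h2 (q := γ - 1) (m := 1) (by push_cast; linarith)
    (by push_cast; linarith)
  have hp2 := rpow_bounds hK h1 h2 (q := γ - 2) (m := 2) (by push_cast; linarith)
    (by push_cast; linarith)
  have hdi := (abs_partialD_le u x i).trans hD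
  have hdj := (abs_partialD_le u x j).trans hD
  have hr := Real.rpow_pos_of_pos hu0 (γ - 1)
  have hr2 := Real.rpow_pos_of_pos hu0 (γ - 2)
  have hg : |γ - 1| ≤ 1 := by rw [abs_le]; constructor <;> linarith
  have hK24 : K ^ 2 ≤ K ^ 4 := pow_le_pow_right₀ hK (by norm_num)
  rw [hessPow, abs_neg]
  refine (abs_add_le _ _).trans ?_
  simp only [abs_mul, abs_of_pos hγ0, abs_of_pos hr, abs_of_pos hr2]
  calc γ * u x ^ (γ - 1) * |partialD2 i j u x| +
        γ * |γ - 1| * u x ^ (γ - 2) * (|partialD i u x| * |partialD j u x|)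
      ≤ 1 * K ^ 1 * K + 1 * 1 * K ^ 2 * (K * K) := by gcongr
    _ ≤ 2 * K ^ 4 := by nlinarith

theorem abs_source_sub_le {n : ℕ} {a : E n → ℝ} {α : Fin n → Fin n → E n → ℝ} {x y : E n}
    {γ η P : ℝ} (hγ0 : 0 < γ) (hγ1 : γ ≤ 1) (ha : |a x - a y| ≤ η)
    (hα : ∀ i j, |α i j x - α i j y| ≤ η) {p : Fin n → ℝ} (hp : ∀ i, |p i| ≤ P) :
    |source γ a α p x - source γ a α p y| ≤ 1 / γ * (n ^ 2 * (η * P ^ 2)) + η := by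
  have hg : 0 ≤ 1 / γ - 1 := by
    rw [sub_nonneg, le_div_iff₀ hγ0]; linarith
  have e : source γ a α p x - source γ a α p y =
      (1 / γ - 1) * ∑ i, ∑ j, (α i j x - α i j y) * (p i * p j) + γ * (a x - a y) := by
    have : ∑ i, ∑ j, (α i j x - α i j y) * (p i * p j) =
        ∑ i, ∑ j, α i j x * p i * p j - ∑ i, ∑ j, α i j y * p i * p j := by
      simp only [← Finset.sum_sub_distrib]
      exact Finset.sum_congr rfl fun i _ => Finset.sum_congr rfl fun j _ => by ring
    rw [this, source, source]; ring
  have h1 := abs_sum_sum_mul_le (fun i j => α i j x - α i j y) (fun i j => p i * p j) hα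
    (d := P ^ 2) (fun i j => by
      rw [abs_mul, sq]
      exact mul_le_mul (hp i) (hp j) (abs_nonneg _) ((abs_nonneg _).trans (hp i)))
  rw [e]
  refine (abs_add_le _ _).trans ?_
  rw [abs_mul, abs_mul, abs_of_nonneg hg, abs_of_pos hγ0]
  refine add_le_add ?_ ?_
  · exact mul_le_mul (by linarith) h1 (abs_nonneg _) (by positivity)
  · exact (mul_le_of_le_one_left (abs_nonneg _) hγ1).trans ha

/-- The harmonic-concavity step: the equation at the three points has right-hand side `Bᵢ / Nᵢ`,
where `N = -v`, and the choice `mᵢ = Nᵢ` of weights makes the second-order condition linear in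
`N₁`, `N₃`. -/
theorem defect_le_of_weighted_trace_le {t N₁ N₂ N₃ B₂ T₁ T₃ κ f c : ℝ}
    (ht0 : 0 ≤ t) (ht1 : t ≤ 1) (hN₁ : 0 < N₁) (hN₂ : 0 < N₂) (hN₃ : 0 < N₃) (hκ : N₂ ≤ κ)
    (hc : 0 < c) (hB₂ : c ≤ B₂) (hf : 0 ≤ f)
    (hT₁ : N₁ * T₁ ≤ B₂ + f) (hT₃ : N₃ * T₃ ≤ B₂ + f)
    (h : (t * N₃ + (1 - t) * N₁) ^ 2 * (B₂ / N₂) ≤ t * N₃ ^ 2 * T₃ + (1 - t) * N₁ ^ 2 * T₁) :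
    t * N₃ + (1 - t) * N₁ - N₂ ≤ κ * f / c := by
  have ht' : 0 ≤ 1 - t := by linarith
  set S := t * N₃ + (1 - t) * N₁ with hS
  have hB0 : 0 < B₂ := hc.trans_le hB₂
  have hS0 : 0 < S := by
    rcases ht0.eq_or_lt with h0 | h0
    · rw [hS, ← h0]; simpa using hN₁
    · have := mul_pos h0 hN₃
      have := mul_nonneg ht' hN₁.le
      linarith
  have h1 : t * N₃ ^ 2 * T₃ + (1 - t) * N₁ ^ 2 * T₁ ≤ S * (B₂ + f) := by
    have a1 := mul_le_mul_of_nonneg_left hT₃ (mul_nonneg ht0 hN₃.le)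
    have a2 := mul_le_mul_of_nonneg_left hT₁ (mul_nonneg ht' hN₁.le)
    rw [hS]; linarith
  have h2 : S * (B₂ / N₂) ≤ B₂ + f := by
    refine le_of_mul_le_mul_left ?_ hS0
    linarith
  have h3 : S * B₂ ≤ N₂ * (B₂ + f) := by
    rw [← mul_div_assoc, div_le_iff₀ hN₂] at h2
    linarith
  rw [le_div_iff₀ hc]
  by_cases hneg : S - N₂ ≤ 0
  · have := mul_nonneg (hN₂.le.trans hκ) hf
    have := mul_nonpos_of_nonpos_of_nonneg hneg hc.le
    linarith
  · push Not at hneg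
    calc (S - N₂) * c ≤ (S - N₂) * B₂ := by gcongr
      _ ≤ N₂ * f := by linarith
      _ ≤ κ * f := by gcongr

/-! ### The interior estimate -/

/-- The constant in the bound of the concavity function, for `γ = (1 - β) / 2`. -/
noncomputable def defectConst (n : ℕ) (γ K : ℝ) : ℝ :=
  K * (1 / γ * (n ^ 2 * (K * (K ^ 2) ^ 2)) + K + K * (n ^ 2 * (K * (2 * K ^ 4)))) / (γ * K⁻¹)

theorem IsSolution.elliptic_nonneg {n : ℕ} {Ω : Set (E n)} {β : ℝ} {a : E n → ℝ}
    {α : Fin n → Fin n → E n → ℝ} {u : E n → ℝ} (hu : IsSolution Ω β a α u) {x : E n}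
    (hx : x ∈ Ω) (p : Fin n → ℝ) : 0 ≤ ∑ i, ∑ j, α i j x * p i * p j := by
  obtain ⟨ζ, hζ, h⟩ := hu.elliptic
  have := h x hx (WithLp.toLp 2 p)
  exact (by positivity : (0 : ℝ) ≤ ζ * ‖(WithLp.toLp 2 p : E n)‖ ^ 2).trans this

theorem IsControl.one_le {n : ℕ} {Ω : Set (E n)} {β : ℝ} {a : E n → ℝ}
    {α : Fin n → Fin n → E n → ℝ} {u : E n → ℝ} {ρ K : ℝ} (hu : IsSolution Ω β a α u)
    (hK : IsControl Ω β a α u ρ K) : 1 ≤ K := by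
  obtain ⟨x, hx, -⟩ := hK.exists_max
  have h := hK.u_bounds x hx
  have h0 : 0 < K := (hu.u_pos x hx.1).trans_le h.2
  have h1 := h.1.trans h.2
  rw [inv_le_iff_one_le_mul₀ h0] at h1
  nlinarith

theorem concavityFn_le_of_isControl {n : ℕ} {Ω : Set (E n)} {β : ℝ} (hβ₀ : 0 ≤ β) (hβ₁ : β < 1)
    {a : E n → ℝ} {α : Fin n → Fin n → E n → ℝ} {u : E n → ℝ} {ρ K ε : ℝ} (ho : IsOpen Ω)
    (hc : Convex ℝ Ω) (hb : Bornology.IsBounded Ω) (hu : IsSolution Ω β a α u) (hρ : 0 < ρ)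
    (hK : IsControl Ω β a α u ρ K) (hε0 : 0 < ε)
    (hε : variation Ω a α < ENNReal.ofReal ε) {q : E n × E n × ℝ} (hq : q ∈ triples Ω) :
    concavityFn (transform β u) q ≤ defectConst n ((1 - β) / 2) K * ε := by
  have hK1 : 1 ≤ K := hK.one_le hu
  have hK0 : 0 < K := by linarith
  obtain ⟨x₁, hx₁, x₃, hx₃, t, ht, hmax⟩ := hK.exists_max
  refine (hmax hq).trans ?_
  have htr : transform β u = fun x => -(u x ^ ((1 - β) / 2)) := rfl
  rw [htr] at hmax ⊢
  set γ := (1 - β) / 2 with hγ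
  have hγ0 : 0 < γ := by rw [hγ]; linarith
  have hγ1 : γ ≤ 1 := by rw [hγ]; linarith
  have hC0 : 0 ≤ defectConst n γ K * ε := by unfold defectConst; positivity
  rcases ht.1.eq_or_lt with rfl | ht0
  · simpa [concavityFn] using hC0
  rcases ht.2.eq_or_lt with rfl | ht1
  · simpa [concavityFn] using hC0
  have hx₂ := combo_mem_innerSet ho hc hρ hx₁ hx₃ ht
  obtain ⟨hp₁, hp₃⟩ := gradPow_eq_at_max ho hc hu.u_C2 hu.u_pos hx₁.1 hx₃.1 ⟨ht0, ht1⟩ hmax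
  have htrace := trace_le_at_max ho hc hu.u_C2 hu.u_pos hx₁.1 hx₃.1 ht hmax
    (fun i j => α i j (t • x₃ + (1 - t) • x₁)) (hu.elliptic_nonneg hx₂.1)
    (u x₁ ^ γ) (u x₃ ^ γ)
  simp only [concavityFn]
  set x₂ := t • x₃ + (1 - t) • x₁
  rw [sum_mul_hessPow hβ₁ hu hx₂.1] at htrace
  have hN : ∀ x ∈ innerSet Ω ρ, 0 < u x ^ γ ∧ u x ^ γ ≤ K := fun x hx => by
    have h := hK.u_bounds x hx
    refine ⟨Real.rpow_pos_of_pos (hu.u_pos x hx.1) γ, ?_⟩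
    simpa using rpow_bounds hK1 h.1 h.2 (q := γ) (m := 1) (by push_cast; linarith)
      (by push_cast; linarith)
  have hgrad : ∀ x ∈ innerSet Ω ρ, ∀ i, |gradPow γ u x i| ≤ K ^ 2 := fun x hx =>
    abs_gradPow_le hK1 hγ0 hγ1 (hK.u_bounds x hx).1 (hK.u_bounds x hx).2 (hK.Du_bound x hx)
  have hdist : ∀ x ∈ Ω, ∀ y ∈ Ω, ε * dist x y ≤ ε * K := fun x hx y hy =>
    mul_le_mul_of_nonneg_left ((Metric.dist_le_diam_of_mem hb hx hy).trans hK.diam_le) hε0.le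
  have hT : ∀ x ∈ innerSet Ω ρ, gradPow γ u x = gradPow γ u x₂ →
      u x ^ γ * ∑ i, ∑ j, α i j x₂ * hessPow γ u x i j ≤
        source γ a α (gradPow γ u x₂) x₂ +
          ((1 / γ * (n ^ 2 * ((ε * K) * (K ^ 2) ^ 2)) + ε * K) +
            K * (n ^ 2 * ((ε * K) * (2 * K ^ 4)))) := by
    intro x hx hp
    have e1 : ∑ i, ∑ j, α i j x₂ * hessPow γ u x i j =
        ∑ i, ∑ j, α i j x * hessPow γ u x i j +
          ∑ i, ∑ j, (α i j x₂ - α i j x) * hessPow γ u x i j := by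
      simp only [← Finset.sum_add_distrib]
      exact Finset.sum_congr rfl fun i _ => Finset.sum_congr rfl fun j _ => by ring
    have h1 := abs_sum_sum_mul_le (fun i j => α i j x₂ - α i j x) (hessPow γ u x)
      (fun i j => (abs_α_sub_le ho hc hu hε hx₂.1 hx.1 i j).trans (hdist _ hx₂.1 _ hx.1))
      (fun i j => abs_hessPow_le hK1 hγ0 hγ1 (hK.u_bounds x hx).1 (hK.u_bounds x hx).2
        (hK.Du_bound x hx) (hK.D2u_bound x hx i j))
    have h2 := abs_source_sub_le hγ0 hγ1
      ((abs_a_sub_le ho hc hu hε hx.1 hx₂.1).trans (hdist _ hx.1 _ hx₂.1))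
      (fun i j => (abs_α_sub_le ho hc hu hε hx.1 hx₂.1 i j).trans (hdist _ hx.1 _ hx₂.1))
      (hgrad x₂ hx₂)
    obtain ⟨hN0, hNK⟩ := hN x hx
    rw [e1, sum_mul_hessPow hβ₁ hu hx.1, mul_add, ← hγ, mul_div_cancel₀ _ hN0.ne', hp]
    have h4 := (mul_le_mul_of_nonneg_left ((le_abs_self _).trans h1) hN0.le).trans
      (mul_le_mul_of_nonneg_right hNK (by positivity))
    linarith [le_abs_self (source γ a α (gradPow γ u x₂) x - source γ a α (gradPow γ u x₂) x₂)]
  have hB : γ * K⁻¹ ≤ source γ a α (gradPow γ u x₂) x₂ := by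
    have h1 := mul_le_mul_of_nonneg_left (hK.a_bounds x₂ hx₂).1 hγ0.le
    have hg : 0 ≤ 1 / γ - 1 := by
      rw [sub_nonneg, le_div_iff₀ hγ0]; linarith
    have h2 := mul_nonneg hg (hu.elliptic_nonneg hx₂.1 (gradPow γ u x₂))
    rw [source]; linarith
  have := defect_le_of_weighted_trace_le ht.1 ht.2 (hN x₁ hx₁).1 (hN x₂ hx₂).1 (hN x₃ hx₃).1
    (hN x₂ hx₂).2 (by positivity) hB (by positivity) (hT x₁ hx₁ hp₁) (hT x₃ hx₃ hp₃) htrace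
  calc _ = t * u x₃ ^ γ + (1 - t) * u x₁ ^ γ - u x₂ ^ γ := by ring
    _ ≤ _ := this
    _ = defectConst n γ K * ε := by rw [defectConst]; ring

/-! ### Cones at boundary points and a barrier -/

/-- A `C¹` boundary point of a convex set is the vertex of truncated cones inside the set whose
aperture is as close to a half-space as desired. -/
theorem exists_cones_of_mem_frontier {n : ℕ} {Ω : Set (E n)} (hΩ : IsAdmissibleDomain Ω)
    {x₁ x₃ : E n} (h₁ : x₁ ∈ frontier Ω) (h₃ : x₃ ∈ Ω) :
    ∃ ℓ : E n →L[ℝ] ℝ, 0 < ℓ (x₃ - x₁) ∧ ∀ κ : ℝ, 0 < κ → ∃ r : ℝ, 0 < r ∧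
      ∀ z : E n, κ * ‖z‖ ≤ ℓ z → ℓ z ≤ r → z ≠ 0 → x₁ + z ∈ Ω := by
  obtain ⟨φ, hφ, hne, hiff⟩ := hΩ.c1_boundary x₁ h₁
  have hd : HasFDerivAt φ (fderiv ℝ φ x₁) x₁ := (hφ.differentiableAt one_ne_zero).hasFDerivAt
  have hx₁ : x₁ ∈ closure Ω ∧ x₁ ∉ Ω := by rwa [hΩ.isOpen.frontier_eq] at h₁
  have hray : ∀ y ∈ Ω, ∀ s : ℝ, 0 < s → s ≤ 1 → x₁ + s • (y - x₁) ∈ Ω := by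
    intro y hy s hs0 hs1
    have := hΩ.convex.combo_closure_interior_mem_interior hx₁.1
      (hΩ.isOpen.interior_eq.symm ▸ hy) (by linarith : 0 ≤ 1 - s) hs0 (by ring)
    rw [hΩ.isOpen.interior_eq] at this
    convert this using 1
    module
  have hφ0 : φ x₁ = 0 := by
    refine le_antisymm ?_ (not_lt.mp fun h => hx₁.2 (hiff.self_of_nhds.mpr h))
    by_contra! hpos
    have hev := hiff.and (hd.continuousAt.eventually (lt_mem_nhds hpos))
    obtain ⟨y, hyΩ, hy⟩ := (mem_closure_iff_frequently.mp hx₁.1).and_eventually hev |>.exists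
    exact lt_asymm (hy.1.mp hyΩ) hy.2
  have hweak : ∀ y ∈ Ω, fderiv ℝ φ x₁ (y - x₁) ≤ 0 := by
    intro y hy
    have hl : HasDerivAt (fun s : ℝ => x₁ + s • (y - x₁)) (y - x₁) 0 := by
      simpa using ((hasDerivAt_id (0 : ℝ)).smul_const (y - x₁)).const_add x₁
    have hcomp : HasDerivAt (fun s : ℝ => φ (x₁ + s • (y - x₁))) (fderiv ℝ φ x₁ (y - x₁)) 0 :=
      HasFDerivAt.comp_hasDerivAt (0 : ℝ) (by simpa using hd) hl
    have ht := hcomp.tendsto_slope_zero_right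
    refine le_of_tendsto ht ?_
    have hev : ∀ᶠ s : ℝ in 𝓝[>] 0, (x₁ + s • (y - x₁) ∈ Ω ↔ φ (x₁ + s • (y - x₁)) < 0) := by
      have : Filter.Tendsto (fun s : ℝ => x₁ + s • (y - x₁)) (𝓝 0) (𝓝 x₁) := by
        simpa using hl.continuousAt.tendsto
      exact (this.mono_left nhdsWithin_le_nhds).eventually hiff
    filter_upwards [hev, Ioc_mem_nhdsGT (zero_lt_one' ℝ)] with s hs hs01
    have := hs.mp (hray y hy s hs01.1 hs01.2)
    simp only [zero_add, zero_smul, add_zero, hφ0, sub_zero, smul_eq_mul]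
    exact mul_nonpos_of_nonneg_of_nonpos (inv_nonneg.mpr hs01.1.le) this.le
  have hstrict : fderiv ℝ φ x₁ (x₃ - x₁) < 0 := by
    obtain ⟨v, hv⟩ : ∃ v, 0 < fderiv ℝ φ x₁ v := by
      by_contra! hall
      refine hne (ContinuousLinearMap.ext fun v => le_antisymm (hall v) ?_)
      have := hall (-v)
      rw [map_neg] at this
      simpa using this
    have hev : ∀ᶠ s : ℝ in 𝓝[>] 0, x₃ + s • v ∈ Ω := by
      have : Filter.Tendsto (fun s : ℝ => x₃ + s • v) (𝓝 0) (𝓝 x₃) := by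
        have : Continuous fun s : ℝ => x₃ + s • v := by fun_prop
        simpa using this.tendsto 0
      exact (this.mono_left nhdsWithin_le_nhds).eventually (hΩ.isOpen.mem_nhds h₃)
    obtain ⟨s, hs, hs0⟩ := (hev.and self_mem_nhdsWithin).exists
    have h := hweak _ hs
    have e : x₃ + s • v - x₁ = (x₃ - x₁) + s • v := by abel
    rw [e, map_add, map_smul, smul_eq_mul] at h
    have := mul_pos (Set.mem_Ioi.mp hs0) hv
    linarith
  refine ⟨-fderiv ℝ φ x₁, by simpa using hstrict, fun κ hκ => ?_⟩
  have hlit := hd.isLittleO.def (half_pos hκ)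
  obtain ⟨δ, hδ, hball⟩ := Metric.eventually_nhds_iff.mp (hiff.and hlit)
  refine ⟨κ * δ / 2, by positivity, fun z hz1 hz2 hz0 => ?_⟩
  have hzpos : 0 < ‖z‖ := norm_pos_iff.mpr hz0
  have hzδ : ‖z‖ < δ := by
    by_contra! hge
    have := mul_le_mul_of_nonneg_left hge hκ.le
    have : 0 < κ * δ := by positivity
    linarith
  obtain ⟨h1, h2⟩ := hball (y := x₁ + z) (by simpa [dist_eq_norm] using hzδ)
  rw [h1]
  rw [hφ0, add_sub_cancel_left, sub_zero, Real.norm_eq_abs] at h2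
  have h3 := (abs_le.mp h2).2
  rw [neg_apply] at hz1
  have := mul_pos hκ hzpos
  linarith

/-- The barrier `y^{7/4} - κ² |z|² y^{-1/4}`, `y = ℓ z`. It is homogeneous of degree `7/4` and, in
the half-space `0 < y`, positive exactly in the open cone `κ |z| < y`. Degree less than `2` makes
square roots of functions above it have infinite slope at the vertex; degree greater than `3/2` makes
it a subsolution for small `κ`. -/
noncomputable def barrier {n : ℕ} (ℓ : E n →L[ℝ] ℝ) (κ : ℝ) (z : E n) : ℝ :=
  ℓ z ^ (7 / 4 : ℝ) - κ ^ 2 * ‖z‖ ^ 2 * ℓ z ^ (-1 / 4 : ℝ)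

/-- The Hessian matrix of `barrier ℓ κ` in the half-space `0 < ℓ z`. -/
noncomputable def barrierHess {n : ℕ} (ℓ : E n →L[ℝ] ℝ) (κ : ℝ) (z : E n) (i j : Fin n) : ℝ :=
  ℓ z ^ (-1 / 4 : ℝ) *
    ((21 / 16 - 5 / 16 * (κ ^ 2 * ‖z‖ ^ 2 / ℓ z ^ 2)) *
        (ℓ (EuclideanSpace.single i 1) * ℓ (EuclideanSpace.single j 1))
      - 2 * κ ^ 2 * (if i = j then 1 else 0)
      + κ ^ 2 / 2 / ℓ z *
        (z i * ℓ (EuclideanSpace.single j 1) + z j * ℓ (EuclideanSpace.single i 1)))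

theorem barrierHess_comm {n : ℕ} (ℓ : E n →L[ℝ] ℝ) (κ : ℝ) (z : E n) (i j : Fin n) :
    barrierHess ℓ κ z i j = barrierHess ℓ κ z j i := by
  simp only [barrierHess, eq_comm (a := i) (b := j)]
  ring

theorem sum_barrierHess {n : ℕ} (ℓ : E n →L[ℝ] ℝ) (κ : ℝ) (z p : E n) :
    ∑ i, ∑ j, barrierHess ℓ κ z i j * p i * p j =
      ℓ z ^ (-1 / 4 : ℝ) * ((21 / 16 - 5 / 16 * (κ ^ 2 * ‖z‖ ^ 2 / ℓ z ^ 2)) * ℓ p ^ 2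
        - 2 * κ ^ 2 * ‖p‖ ^ 2 + κ ^ 2 / ℓ z * (inner ℝ z p * ℓ p)) := by
  have e1 : ℓ p ^ 2 = ∑ i, ∑ j, (ℓ (EuclideanSpace.single i 1) * p i) *
      (ℓ (EuclideanSpace.single j 1) * p j) := by
    rw [sq, ← Finset.sum_mul_sum, ← map_eq_sum]
  have e2 : ‖p‖ ^ 2 = ∑ i, ∑ j, (if i = j then p i * p j else 0) := by
    rw [EuclideanSpace.real_norm_sq_eq]
    exact Finset.sum_congr rfl fun i _ => by simp [sq]
  have hin : inner ℝ z p = ∑ i, z i * p i := by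
    rw [PiLp.inner_apply]
    exact Finset.sum_congr rfl fun i _ => by simp [mul_comm]
  have e3 : inner ℝ z p * ℓ p = ∑ i, ∑ j, (z i * p i) * (ℓ (EuclideanSpace.single j 1) * p j) := by
    rw [← Finset.sum_mul_sum, ← map_eq_sum, hin]
  have e4 : inner ℝ z p * ℓ p = ∑ i, ∑ j, (ℓ (EuclideanSpace.single i 1) * p i) * (z j * p j) := by
    rw [← Finset.sum_mul_sum, ← map_eq_sum, hin, mul_comm]
  have e5 : κ ^ 2 / ℓ z * (inner ℝ z p * ℓ p) =
      κ ^ 2 / 2 / ℓ z * (inner ℝ z p * ℓ p) + κ ^ 2 / 2 / ℓ z * (inner ℝ z p * ℓ p) := by ring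
  rw [e5]
  nth_rewrite 1 [e3]
  rw [e4, e1, e2]
  simp only [Finset.mul_sum, ← Finset.sum_sub_distrib, ← Finset.sum_add_distrib]
  refine Finset.sum_congr rfl fun i _ => Finset.sum_congr rfl fun j _ => ?_
  rw [barrierHess]
  split_ifs <;> ring

theorem hasTwoJet_barrier {n : ℕ} (ℓ : E n →L[ℝ] ℝ) (κ : ℝ) {z : E n} (hz : 0 < ℓ z) (p : E n) :
    ∃ f₁, HasTwoJet (fun s : ℝ => barrier ℓ κ (z + s • p)) f₁
      (∑ i, ∑ j, barrierHess ℓ κ z i j * p i * p j) := by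
  have hl := HasTwoJet.quadratic (ℓ z) (ℓ p) 0
  have hq := (HasTwoJet.quadratic (‖z‖ ^ 2) (2 * inner ℝ z p) (‖p‖ ^ 2)).const_mul (κ ^ 2)
  have h := (hl.rpow (by simpa using hz) (7 / 4)).sub
    (hq.mul (hl.rpow (by simpa using hz) (-1 / 4)))
  obtain ⟨f₁, h⟩ := Exists.intro (p := fun f₁ => HasTwoJet _ f₁ _) _ h
  refine ⟨f₁, ?_⟩
  convert h using 1
  · ext s
    have e : ‖z + s • p‖ ^ 2 = ‖z‖ ^ 2 + s * (2 * inner ℝ z p) + s ^ 2 * ‖p‖ ^ 2 := by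
      rw [norm_add_sq_real, inner_smul_right, norm_smul, mul_pow, Real.norm_eq_abs, sq_abs]
      ring
    rw [barrier, e, map_add, map_smul, smul_eq_mul, mul_zero, add_zero]
  · rw [sum_barrierHess]
    have r1 : ℓ z ^ (-1 / 4 - 1 : ℝ) = ℓ z ^ (-1 / 4 : ℝ) / ℓ z := Real.rpow_sub_one hz.ne' _
    have r2 : ℓ z ^ (-1 / 4 - 2 : ℝ) = ℓ z ^ (-1 / 4 : ℝ) / ℓ z ^ 2 := by
      rw [Real.rpow_sub hz, Real.rpow_two]
    have r3 : ℓ z ^ (7 / 4 - 2 : ℝ) = ℓ z ^ (-1 / 4 : ℝ) := by norm_num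
    simp only [zero_mul, mul_zero, add_zero, ne_eq, OfNat.ofNat_ne_zero, not_false_eq_true,
      zero_pow, r1, r2, r3]
    ring

/-- The barrier is a strict subsolution in a cone whose aperture is close to a half-space, however
large the ellipticity ratio. -/
theorem sum_mul_barrierHess_pos {n : ℕ} (ℓ : E n →L[ℝ] ℝ) {κ Λ s₀ : ℝ} (hκ0 : 0 < κ)
    (hκ1 : κ ≤ 1) {z : E n} (hz : 0 < ℓ z) (hcone : κ * ‖z‖ ≤ ℓ z) (A : Fin n → Fin n → ℝ)
    (hA : ∀ i j, |A i j| ≤ Λ) (hΛ : 0 ≤ Λ) (hs0 : 0 < s₀)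
    (hs : s₀ ≤ ∑ i, ∑ j, A i j * ℓ (EuclideanSpace.single i 1) * ℓ (EuclideanSpace.single j 1))
    (hκ : κ * (2 * (n ^ 2 * Λ) + n ^ 2 * (Λ * ‖ℓ‖)) < s₀) :
    0 < ∑ i, ∑ j, A i j * barrierHess ℓ κ z i j := by
  set S := ∑ i, ∑ j, A i j * ℓ (EuclideanSpace.single i 1) * ℓ (EuclideanSpace.single j 1) with hS
  set T := ∑ i, ∑ j, A i j * (if i = j then (1 : ℝ) else 0) with hT
  set R := ∑ i, ∑ j, A i j *
    (z i * ℓ (EuclideanSpace.single j 1) + z j * ℓ (EuclideanSpace.single i 1)) with hR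
  have e : ∑ i, ∑ j, A i j * barrierHess ℓ κ z i j = ℓ z ^ (-1 / 4 : ℝ) *
      ((21 / 16 - 5 / 16 * (κ ^ 2 * ‖z‖ ^ 2 / ℓ z ^ 2)) * S - 2 * κ ^ 2 * T
        + κ ^ 2 / 2 / ℓ z * R) := by
    rw [hS, hT, hR]
    simp only [Finset.mul_sum, ← Finset.sum_sub_distrib, ← Finset.sum_add_distrib]
    refine Finset.sum_congr rfl fun i _ => Finset.sum_congr rfl fun j _ => ?_
    rw [barrierHess]; ring
  have hν : ∀ i, |ℓ (EuclideanSpace.single i 1)| ≤ ‖ℓ‖ := fun i => by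
    simpa using ℓ.le_opNorm (EuclideanSpace.single i (1 : ℝ))
  have hzi : ∀ i, |z i| ≤ ‖z‖ := fun i => by simpa using PiLp.norm_apply_le z i
  have hT' : T ≤ n ^ 2 * (Λ * 1) := (le_abs_self _).trans
    (abs_sum_sum_mul_le A (fun i j => if i = j then (1 : ℝ) else 0) hA
      fun i j => by split_ifs <;> simp)
  have hR' : |R| ≤ n ^ 2 * (Λ * (2 * (‖z‖ * ‖ℓ‖))) := by
    refine abs_sum_sum_mul_le A _ hA fun i j => (abs_add_le _ _).trans ?_
    rw [abs_mul, abs_mul, two_mul]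
    exact add_le_add (mul_le_mul (hzi i) (hν j) (abs_nonneg _) (norm_nonneg _))
      (mul_le_mul (hzi j) (hν i) (abs_nonneg _) (norm_nonneg _))
  have hq : κ ^ 2 * ‖z‖ ^ 2 / ℓ z ^ 2 ≤ 1 := by
    rw [div_le_one (by positivity), ← mul_pow]
    exact pow_le_pow_left₀ (by positivity) hcone 2
  have h1 : s₀ ≤ (21 / 16 - 5 / 16 * (κ ^ 2 * ‖z‖ ^ 2 / ℓ z ^ 2)) * S :=
    hs.trans (le_mul_of_one_le_left (hs0.le.trans hs) (by linarith))
  have h2 : 2 * κ ^ 2 * T ≤ κ * (2 * (n ^ 2 * Λ)) := by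
    have : κ ^ 2 ≤ κ := by nlinarith
    calc 2 * κ ^ 2 * T ≤ 2 * κ ^ 2 * (n ^ 2 * (Λ * 1)) := by gcongr
      _ ≤ 2 * κ * (n ^ 2 * (Λ * 1)) := by gcongr
      _ = _ := by ring
  have h3 : -(κ * (n ^ 2 * (Λ * ‖ℓ‖))) ≤ κ ^ 2 / 2 / ℓ z * R := by
    have hc : 0 ≤ κ ^ 2 / 2 / ℓ z := by positivity
    have b1 : κ ^ 2 / 2 / ℓ z * |R| ≤ κ * (n ^ 2 * (Λ * ‖ℓ‖)) := by
      calc κ ^ 2 / 2 / ℓ z * |R| ≤ κ ^ 2 / 2 / ℓ z * (n ^ 2 * (Λ * (2 * (‖z‖ * ‖ℓ‖)))) := by gcongr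
        _ = κ * (n ^ 2 * (Λ * ‖ℓ‖)) * (κ * ‖z‖ / ℓ z) := by ring
        _ ≤ κ * (n ^ 2 * (Λ * ‖ℓ‖)) * 1 := by
            gcongr
            rwa [div_le_one hz]
        _ = _ := mul_one _
    have b2 := mul_le_mul_of_nonneg_left (neg_abs_le R) hc
    linarith
  rw [e]
  exact mul_pos (Real.rpow_pos_of_pos hz _) (by linarith)

theorem barrier_le {n : ℕ} (ℓ : E n →L[ℝ] ℝ) (κ : ℝ) {z : E n} (hz : 0 ≤ ℓ z) :
    barrier ℓ κ z ≤ ℓ z ^ (7 / 4 : ℝ) := by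
  rw [barrier]
  have : 0 ≤ κ ^ 2 * ‖z‖ ^ 2 * ℓ z ^ (-1 / 4 : ℝ) := by positivity
  linarith

theorem barrier_eq {n : ℕ} (ℓ : E n →L[ℝ] ℝ) (κ : ℝ) {z : E n} (hz : 0 < ℓ z) :
    barrier ℓ κ z = ℓ z ^ (-1 / 4 : ℝ) * (ℓ z ^ 2 - (κ * ‖z‖) ^ 2) := by
  have : ℓ z ^ (7 / 4 : ℝ) = ℓ z ^ (-1 / 4 : ℝ) * ℓ z ^ 2 := by
    rw [← Real.rpow_two, ← Real.rpow_add hz]; norm_num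
  rw [barrier, this]; ring

theorem continuousOn_barrier {n : ℕ} (ℓ : E n →L[ℝ] ℝ) {κ : ℝ} (hκ : 0 < κ) :
    ContinuousOn (barrier ℓ κ) {z | κ * ‖z‖ ≤ ℓ z} := by
  intro z hz
  have hz' : κ * ‖z‖ ≤ ℓ z := hz
  by_cases h0 : z = 0
  · -- At the vertex the barrier is squeezed between `0` and `y^{7/4}`.
    subst h0
    have hv : barrier ℓ κ 0 = 0 := by simp [barrier]
    rw [ContinuousWithinAt, hv]
    have hup : Filter.Tendsto (fun z => ℓ z ^ (7 / 4 : ℝ)) (𝓝[{z | κ * ‖z‖ ≤ ℓ z}] 0) (𝓝 0) := by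
      have : Continuous fun z => ℓ z ^ (7 / 4 : ℝ) :=
        ℓ.continuous.rpow_const fun _ => Or.inr (by norm_num)
      simpa using (this.tendsto 0).mono_left nhdsWithin_le_nhds
    refine tendsto_of_tendsto_of_tendsto_of_le_of_le' tendsto_const_nhds hup ?_ ?_
    · filter_upwards [self_mem_nhdsWithin] with y hy
      have hy' : κ * ‖y‖ ≤ ℓ y := hy
      by_cases hy0 : y = 0
      · rw [hy0, hv]
      · have hpos : 0 < ℓ y := (mul_pos hκ (norm_pos_iff.mpr hy0)).trans_le hy'
        rw [barrier_eq ℓ κ hpos]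
        refine mul_nonneg (Real.rpow_nonneg hpos.le _) (sub_nonneg.mpr ?_)
        exact pow_le_pow_left₀ (by positivity) hy' 2
    · filter_upwards [self_mem_nhdsWithin] with y hy
      have hy' : κ * ‖y‖ ≤ ℓ y := hy
      exact barrier_le ℓ κ ((by positivity : 0 ≤ κ * ‖y‖).trans hy')
  · have hpos : 0 < ℓ z := (mul_pos hκ (norm_pos_iff.mpr h0)).trans_le hz'
    refine ContinuousAt.continuousWithinAt ?_
    unfold barrier
    have hc := ℓ.continuous.continuousAt (x := z)
    exact (hc.rpow_const (Or.inl hpos.ne')).sub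
      (((continuous_norm.pow 2).continuousAt.const_mul _ ).mul
        (hc.rpow_const (Or.inl hpos.ne')))

/-! ### Growth of the solution at the boundary -/

theorem exists_abs_α_le {n : ℕ} {Ω : Set (E n)} {β : ℝ} (ho : IsOpen Ω) (hc : Convex ℝ Ω)
    (hb : Bornology.IsBounded Ω) (hne : Ω.Nonempty)
    {a : E n → ℝ} {α : Fin n → Fin n → E n → ℝ} {u : E n → ℝ} (hu : IsSolution Ω β a α u)
    (hvar : variation Ω a α < ⊤) : ∃ Λ : ℝ, 0 ≤ Λ ∧ ∀ x ∈ Ω, ∀ i j, |α i j x| ≤ Λ := by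
  obtain ⟨y, hy⟩ := hne
  have hε : variation Ω a α < ENNReal.ofReal ((variation Ω a α).toReal + 1) := by
    rw [ENNReal.lt_ofReal_iff_toReal_lt hvar.ne]; linarith
  set ε := (variation Ω a α).toReal + 1 with hεdef
  have hε0 : 0 ≤ ε := by rw [hεdef]; positivity
  refine ⟨∑ i, ∑ j, |α i j y| + ε * Metric.diam Ω, by positivity, fun x hx i j => ?_⟩
  have h1 := abs_α_sub_le ho hc hu hε hx hy i j
  have h2 : ε * dist x y ≤ ε * Metric.diam Ω :=
    mul_le_mul_of_nonneg_left (Metric.dist_le_diam_of_mem hb hx hy) hε0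
  have h3 : |α i j y| ≤ ∑ i, ∑ j, |α i j y| :=
    (Finset.single_le_sum (f := fun j => |α i j y|) (fun _ _ => abs_nonneg _)
      (Finset.mem_univ j)).trans
    (Finset.single_le_sum (f := fun i => ∑ j, |α i j y|)
      (fun _ _ => Finset.sum_nonneg fun _ _ => abs_nonneg _) (Finset.mem_univ i))
  have h4 := abs_sub_abs_le_abs_sub (α i j x) (α i j y)
  linarith

/-- Comparison of a solution with a strict subsolution that vanishes on the lateral boundary of a
truncated cone. -/
theorem exists_mul_barrier_le {n : ℕ} {Ω : Set (E n)} {β : ℝ} (ho : IsOpen Ω)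
    {a : E n → ℝ} {α : Fin n → Fin n → E n → ℝ} {u : E n → ℝ} (hu : IsSolution Ω β a α u)
    {x₁ : E n} (h₁ : x₁ ∈ frontier Ω) {ℓ : E n →L[ℝ] ℝ} {κ r : ℝ} (hκ : 0 < κ) (hr : 0 < r)
    (hcone : ∀ z : E n, κ * ‖z‖ ≤ ℓ z → ℓ z ≤ r → z ≠ 0 → x₁ + z ∈ Ω)
    (hsub : ∀ z : E n, κ * ‖z‖ ≤ ℓ z → ℓ z ≤ r → z ≠ 0 →
      0 < ∑ i, ∑ j, α i j (x₁ + z) * barrierHess ℓ κ z i j) :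
    ∃ c : ℝ, 0 < c ∧ ∀ z : E n, κ * ‖z‖ ≤ ℓ z → ℓ z ≤ r → c * barrier ℓ κ z ≤ u (x₁ + z) := by
  set D : Set (E n) := {z | κ * ‖z‖ ≤ ℓ z} ∩ {z | ℓ z ≤ r} with hD
  have hDcl : IsClosed D :=
    (isClosed_le (by fun_prop) (by fun_prop)).inter (isClosed_le (by fun_prop) (by fun_prop))
  have hDc : IsCompact D := by
    refine Metric.isCompact_of_isClosed_isBounded hDcl
      ((Metric.isBounded_closedBall (x := (0 : E n)) (r := r / κ)).subset fun z hz => ?_)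
    rw [mem_closedBall_zero_iff, le_div_iff₀ hκ, mul_comm]
    exact le_trans hz.1 hz.2
  have hpos : ∀ z ∈ D, z ≠ 0 → 0 < ℓ z := fun z hz h0 =>
    (mul_pos hκ (norm_pos_iff.mpr h0)).trans_le hz.1
  have hmem : ∀ z ∈ D, z ≠ 0 → x₁ + z ∈ Ω := fun z hz h0 => hcone z hz.1 hz.2 h0
  have hcl : Set.MapsTo (fun z => x₁ + z) D (closure Ω) := by
    intro z hz
    by_cases h0 : z = 0
    · simpa [h0] using frontier_subset_closure h₁
    · exact subset_closure (hmem z hz h0)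
  have hucont : ContinuousOn (fun z => u (x₁ + z)) D :=
    hu.u_C1_closure.continuousOn.comp (by fun_prop) hcl
  obtain ⟨c₀, hc₀, htop⟩ : ∃ c₀ : ℝ, 0 < c₀ ∧ ∀ z ∈ D ∩ {z | ℓ z = r}, c₀ ≤ u (x₁ + z) := by
    refine (hDc.inter_right (isClosed_eq (by fun_prop) (by fun_prop))).exists_forall_le'
      (hucont.mono Set.inter_subset_left) fun z hz => hu.u_pos _ (hmem z hz.1 fun h0 => ?_)
    have : ℓ z = r := hz.2
    rw [h0, map_zero] at this
    exact hr.ne this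
  have hr7 : 0 < r ^ (7 / 4 : ℝ) := Real.rpow_pos_of_pos hr _
  set c := c₀ / r ^ (7 / 4 : ℝ) with hcdef
  have hc : 0 < c := by positivity
  refine ⟨c, hc, ?_⟩
  have hbc : ContinuousOn (barrier ℓ κ) D :=
    (continuousOn_barrier ℓ hκ).mono Set.inter_subset_left
  obtain ⟨z, hz, hmin⟩ := hDc.exists_isMinOn (f := fun z => u (x₁ + z) - c * barrier ℓ κ z)
    ⟨0, by simp [hD, hr.le]⟩ (hucont.sub (hbc.const_mul c))
  suffices h : 0 ≤ u (x₁ + z) - c * barrier ℓ κ z by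
    intro y hy1 hy2
    have : u (x₁ + z) - c * barrier ℓ κ z ≤ u (x₁ + y) - c * barrier ℓ κ y := hmin ⟨hy1, hy2⟩
    linarith
  by_contra! hneg
  have hz0 : z ≠ 0 := by
    rintro rfl
    have := hu.u_boundary x₁ h₁
    simp [barrier, this] at hneg
  have hzΩ := hmem z hz hz0
  have hzpos := hpos z hz hz0
  have hup := hu.u_pos _ hzΩ
  have hlt1 : ℓ z < r := by
    refine lt_of_le_of_ne hz.2 fun heq => ?_
    have h1 := htop z ⟨hz, heq⟩
    have h2 := mul_le_mul_of_nonneg_left (barrier_le ℓ κ hzpos.le) hc.le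
    rw [heq, hcdef, div_mul_cancel₀ _ hr7.ne'] at h2
    linarith
  have hlt2 : κ * ‖z‖ < ℓ z := by
    refine lt_of_le_of_ne hz.1 fun heq => ?_
    rw [barrier_eq ℓ κ hzpos, heq, sub_self, mul_zero, mul_zero] at hneg
    linarith
  have hu2 : ContDiffAt ℝ 2 u (x₁ + z) := hu.u_C2.contDiffAt (ho.mem_nhds hzΩ)
  have htr := sum_mul_nonneg_of_quadratic_nonneg (fun i j => α i j (x₁ + z))
    (fun i j => partialD2 i j u (x₁ + z) - c * barrierHess ℓ κ z i j)
    (hu.elliptic_nonneg hzΩ)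
    (fun i j => by rw [partialD2_comm hu2, barrierHess_comm])
    (fun p => by
      obtain ⟨f₁, hj⟩ := hasTwoJet_barrier ℓ κ hzpos (WithLp.toLp 2 p)
      have h := ((hj.const_mul c).sub
        (hasTwoJet_line hu2 (WithLp.toLp 2 p))).eq_zero_and_nonpos_of_isLocalMax ?_
      · refine (neg_nonneg.mpr h.2).trans_eq ?_
        simp only [Finset.mul_sum, ← Finset.sum_sub_distrib, ← Finset.sum_neg_distrib]
        exact Finset.sum_congr rfl fun i _ => Finset.sum_congr rfl fun j _ => by ring
      · have hline : Filter.Tendsto (fun s : ℝ => z + s • (WithLp.toLp 2 p : E n)) (𝓝 0)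
            (𝓝 z) := by
          have : Continuous fun s : ℝ => z + s • (WithLp.toLp 2 p : E n) := by fun_prop
          simpa using this.tendsto 0
        have hopen : IsOpen ({z : E n | κ * ‖z‖ < ℓ z} ∩ {z | ℓ z < r}) :=
          (isOpen_lt (by fun_prop) (by fun_prop)).inter (isOpen_lt (by fun_prop) (by fun_prop))
        filter_upwards [hline.eventually (hopen.mem_nhds ⟨hlt2, hlt1⟩)] with s hs
        have h1 : κ * ‖z + s • (WithLp.toLp 2 p : E n)‖ < ℓ (z + s • WithLp.toLp 2 p) := hs.1
        have h2 : ℓ (z + s • WithLp.toLp 2 p) < r := hs.2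
        have h3 : u (x₁ + z) - c * barrier ℓ κ z ≤
          u (x₁ + (z + s • WithLp.toLp 2 p)) - c * barrier ℓ κ (z + s • WithLp.toLp 2 p) :=
          hmin ⟨h1.le, h2.le⟩
        rw [← add_assoc] at h3
        simp only [zero_smul, add_zero]
        linarith)
  have hs := mul_pos hc (hsub z hz.1 hz.2 hz0)
  have heq := hu.equation _ hzΩ
  have hrhs := mul_pos (hu.a_pos _ hzΩ) (Real.rpow_pos_of_pos hup β)
  have e : ∑ i, ∑ j, α i j (x₁ + z) * (partialD2 i j u (x₁ + z) - c * barrierHess ℓ κ z i j) =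
      ∑ i, ∑ j, α i j (x₁ + z) * partialD2 i j u (x₁ + z) -
        c * ∑ i, ∑ j, α i j (x₁ + z) * barrierHess ℓ κ z i j := by
    simp only [Finset.mul_sum, ← Finset.sum_sub_distrib]
    exact Finset.sum_congr rfl fun i _ => Finset.sum_congr rfl fun j _ => by ring
  rw [e] at htr
  linarith

/-- A substitute for Hopf's lemma, which may fail on `C¹` domains: the solution grows at least like
the power `7/4` of the distance along every segment from a boundary point into the domain. -/
theorem exists_mul_rpow_le_of_mem_frontier {n : ℕ} {Ω : Set (E n)} {β : ℝ}
    (hΩ : IsAdmissibleDomain Ω) {a : E n → ℝ} {α : Fin n → Fin n → E n → ℝ} {u : E n → ℝ}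
    (hu : IsSolution Ω β a α u) (hvar : variation Ω a α < ⊤) {x₁ x₃ : E n}
    (h₁ : x₁ ∈ frontier Ω) (h₃ : x₃ ∈ Ω) :
    ∃ c : ℝ, 0 < c ∧ ∀ᶠ s : ℝ in 𝓝[>] 0, c * s ^ (7 / 4 : ℝ) ≤ u (x₁ + s • (x₃ - x₁)) := by
  obtain ⟨ℓ, hℓ, hcones⟩ := exists_cones_of_mem_frontier hΩ h₁ h₃
  obtain ⟨Λ, hΛ, hα⟩ := exists_abs_α_le hΩ.isOpen hΩ.convex hΩ.isBounded hΩ.nonempty hu hvar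
  obtain ⟨ζ, hζ, hell⟩ := hu.elliptic
  set d := x₃ - x₁ with hd
  set ν : E n := WithLp.toLp 2 fun i => ℓ (EuclideanSpace.single i 1) with hν
  have hν0 : ν ≠ 0 := by
    intro h
    rw [map_eq_sum ℓ d] at hℓ
    refine hℓ.ne' (Finset.sum_eq_zero fun i _ => ?_)
    have : ν i = 0 := by rw [h]; rfl
    rw [show ℓ (EuclideanSpace.single i 1) = ν i from rfl, this, zero_mul]
  have hs₀ : 0 < ζ * ‖ν‖ ^ 2 := mul_pos hζ (pow_pos (norm_pos_iff.mpr hν0) 2)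
  have hsmall : ∀ X Y : ℝ, 0 < Y → ∀ᶠ κ : ℝ in 𝓝[>] 0, κ * X < Y := by
    intro X Y hY
    have : Continuous fun κ : ℝ => κ * X := by fun_prop
    have ht : Filter.Tendsto (fun κ : ℝ => κ * X) (𝓝 0) (𝓝 0) := by simpa using this.tendsto 0
    exact (ht.mono_left nhdsWithin_le_nhds).eventually (gt_mem_nhds hY)
  obtain ⟨κ, ⟨⟨hκa, hκb⟩, hκc⟩, hκ0⟩ := (((hsmall 1 1 one_pos).and
    (hsmall (2 * (n ^ 2 * Λ) + n ^ 2 * (Λ * ‖ℓ‖)) _ hs₀)).and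
    (hsmall ‖d‖ _ hℓ)).and self_mem_nhdsWithin |>.exists
  rw [mul_one] at hκa
  have hκ0 : 0 < κ := hκ0
  obtain ⟨r, hr, hcone⟩ := hcones κ hκ0
  obtain ⟨c, hc, hle⟩ := exists_mul_barrier_le hΩ.isOpen hu h₁ hκ0 hr hcone
    fun z hz1 hz2 hz0 => sum_mul_barrierHess_pos ℓ hκ0 hκa.le
      ((mul_pos hκ0 (norm_pos_iff.mpr hz0)).trans_le hz1) hz1 _
      (hα _ (hcone z hz1 hz2 hz0)) hΛ hs₀ (hell _ (hcone z hz1 hz2 hz0) ν) hκb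
  set b := ℓ d ^ (-1 / 4 : ℝ) * (ℓ d ^ 2 - (κ * ‖d‖) ^ 2) with hb
  have hb0 : 0 < b := mul_pos (Real.rpow_pos_of_pos hℓ _)
    (sub_pos.mpr (pow_lt_pow_left₀ hκc (by positivity) two_ne_zero))
  refine ⟨c * b, mul_pos hc hb0, ?_⟩
  filter_upwards [hsmall (ℓ d) r hr, self_mem_nhdsWithin] with s hs hs0
  have hs0 : 0 < s := hs0
  have hℓs : ℓ (s • d) = s * ℓ d := by rw [map_smul, smul_eq_mul]
  have hns : ‖s • d‖ = s * ‖d‖ := by rw [norm_smul, Real.norm_eq_abs, abs_of_pos hs0]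
  have h := hle (s • d) (by rw [hℓs, hns]; nlinarith) (by rw [hℓs]; exact hs.le)
  rw [barrier_eq ℓ κ (by rw [hℓs]; positivity), hℓs, hns, Real.mul_rpow hs0.le hℓ.le] at h
  have e : s ^ (7 / 4 : ℝ) = s ^ (-1 / 4 : ℝ) * s ^ 2 := by
    rw [← Real.rpow_two, ← Real.rpow_add hs0]; norm_num
  refine le_of_eq_of_le ?_ h
  rw [hb, e]; ring

/-! ### Existence of an interior maximum and of a control -/

section Control

variable {n : ℕ} {Ω : Set (E n)} {β : ℝ} {a : E n → ℝ} {α : Fin n → Fin n → E n → ℝ} {u : E n → ℝ}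

theorem isMaxOn_concavityFn_symm {w : E n → ℝ} {x₁ x₃ : E n} {t : ℝ}
    (h : IsMaxOn (concavityFn w) (triples Ω) (x₁, x₃, t)) :
    IsMaxOn (concavityFn w) (triples Ω) (x₃, x₁, 1 - t) := by
  intro q hq
  have := h hq
  simp only [Set.mem_ofPred_eq, concavityFn] at this ⊢
  rw [sub_sub_cancel, add_comm ((1 - t) • x₁)]
  linarith

/-- At a boundary point `x₁` the function `v = -u^γ` has slope `-∞` in the direction of `x₃`, so
moving `x₁` inwards increases the concavity function. -/
theorem not_isMaxOn_of_mem_frontier (hβ₀ : 0 ≤ β) (hβ₁ : β < 1) (hΩ : IsAdmissibleDomain Ω)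
    (hu : IsSolution Ω β a α u) (hvar : variation Ω a α < ⊤) {x₁ x₃ : E n}
    (h₁ : x₁ ∈ frontier Ω) (h₃ : x₃ ∈ Ω) {t : ℝ} (ht : t ∈ Set.Ioo (0 : ℝ) 1) :
    ¬ IsMaxOn (concavityFn (transform β u)) (triples Ω) (x₁, x₃, t) := by
  intro hmax
  obtain ⟨c, hc, hev⟩ := exists_mul_rpow_le_of_mem_frontier hΩ hu hvar h₁ h₃
  have htr : transform β u = fun x => -(u x ^ ((1 - β) / 2)) := rfl
  rw [htr] at hmax
  set γ := (1 - β) / 2 with hγ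
  have hγ0 : 0 < γ := by rw [hγ]; linarith
  have ht1 : 0 < 1 - t := by linarith [ht.2]
  set d := x₃ - x₁ with hd
  have h₁c : x₁ ∈ closure Ω := frontier_subset_closure h₁
  have hray : ∀ s : ℝ, 0 < s → s ≤ 1 → x₁ + s • d ∈ Ω := by
    intro s hs0 hs1
    have := hΩ.convex.combo_closure_interior_mem_interior h₁c
      (hΩ.isOpen.interior_eq.symm ▸ h₃) (by linarith : 0 ≤ 1 - s) hs0 (by ring)
    rw [hΩ.isOpen.interior_eq] at this
    convert this using 1
    rw [hd]; module
  have hx₂ : t • x₃ + (1 - t) • x₁ ∈ Ω := by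
    convert hray t ht.1 ht.2.le using 1
    rw [hd]; module
  set x₂ := t • x₃ + (1 - t) • x₁ with hx₂def
  have hder := (hasTwoJet_neg_rpow_line (hu.u_C2.contDiffAt (hΩ.isOpen.mem_nhds hx₂))
    (hu.u_pos _ hx₂) γ ((1 - t) • d)).hasDerivAt
  have hlim := hder.tendsto_slope_zero_right
  have hpow : Filter.Tendsto (fun s : ℝ => s ^ (1 / 8 : ℝ)) (𝓝[>] 0) (𝓝 0) := by
    have : Continuous fun s : ℝ => s ^ (1 / 8 : ℝ) :=
      continuous_id.rpow_const fun _ => Or.inr (by norm_num)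
    simpa using (this.tendsto 0).mono_left nhdsWithin_le_nhds
  have hprod := (hlim.mul hpow).neg
  rw [mul_zero, neg_zero] at hprod
  have hcγ : 0 < (1 - t) * c ^ γ := mul_pos ht1 (Real.rpow_pos_of_pos hc γ)
  refine hcγ.not_ge (ge_of_tendsto hprod ?_)
  filter_upwards [hev, Ioc_mem_nhdsGT (zero_lt_one' ℝ)] with s hs hs01
  have hs0 : 0 < s := hs01.1
  have h := hmax (show (x₁ + s • d, x₃, t) ∈ triples Ω from
    ⟨subset_closure (hray s hs0 hs01.2), subset_closure h₃, ht.1.le, ht.2.le⟩)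
  simp only [Set.mem_ofPred_eq, concavityFn] at h
  have e : t • x₃ + (1 - t) • (x₁ + s • d) = x₂ + s • (1 - t) • d := by
    rw [hx₂def]; module
  rw [e, ← hx₂def, hu.u_boundary x₁ h₁, Real.zero_rpow hγ0.ne'] at h
  have h1 : c ^ γ * s ^ (7 / 8 : ℝ) ≤ u (x₁ + s • d) ^ γ := by
    have h2 := Real.rpow_le_rpow (by positivity) hs hγ0.le
    rw [Real.mul_rpow hc.le (by positivity), ← Real.rpow_mul hs0.le] at h2
    refine le_trans ?_ h2
    refine mul_le_mul_of_nonneg_left ?_ (by positivity)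
    exact Real.rpow_le_rpow_of_exponent_ge hs0 hs01.2 (by rw [hγ]; linarith)
  have h2 := mul_le_mul_of_nonneg_left h1 ht1.le
  have e8 : s ^ (7 / 8 : ℝ) * s ^ (1 / 8 : ℝ) = s := by
    rw [← Real.rpow_add hs0]; norm_num
  have h8 : 0 < s ^ (1 / 8 : ℝ) := Real.rpow_pos_of_pos hs0 _
  simp only [zero_add, zero_smul, add_zero, smul_eq_mul]
  set F := -(u (x₂ + s • (1 - t) • d) ^ γ) - -(u x₂ ^ γ) with hF
  have h3 : (1 - t) * (c ^ γ * s ^ (7 / 8 : ℝ)) ≤ -F := by rw [hF]; linarith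
  have h4 := mul_le_mul_of_nonneg_right h3 (div_nonneg h8.le hs0.le)
  calc (1 - t) * c ^ γ = (1 - t) * c ^ γ * (s ^ (7 / 8 : ℝ) * s ^ (1 / 8 : ℝ) / s) := by
        rw [e8, div_self hs0.ne', mul_one]
    _ = (1 - t) * (c ^ γ * s ^ (7 / 8 : ℝ)) * (s ^ (1 / 8 : ℝ) / s) := by ring
    _ ≤ -F * (s ^ (1 / 8 : ℝ) / s) := h4
    _ = -(s⁻¹ * F * s ^ (1 / 8 : ℝ)) := by ring

theorem continuousOn_transform (hβ₁ : β < 1) (hu : IsSolution Ω β a α u) :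
    ContinuousOn (transform β u) (closure Ω) :=
  (hu.u_C1_closure.continuousOn.rpow_const fun _ _ => Or.inr (by linarith)).neg

theorem exists_interior_max (hβ₀ : 0 ≤ β) (hβ₁ : β < 1) (hΩ : IsAdmissibleDomain Ω)
    (hu : IsSolution Ω β a α u) (hvar : variation Ω a α < ⊤) :
    ∃ x₁ ∈ Ω, ∃ x₃ ∈ Ω, ∃ t ∈ Set.Icc (0 : ℝ) 1,
      IsMaxOn (concavityFn (transform β u)) (triples Ω) (x₁, x₃, t) := by
  obtain ⟨x₀, hx₀⟩ := hΩ.nonempty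
  have hcc : Convex ℝ (closure Ω) := hΩ.convex.closure
  have hcomp : IsCompact (triples Ω) :=
    hΩ.isBounded.isCompact_closure.prod (hΩ.isBounded.isCompact_closure.prod isCompact_Icc)
  have hv := continuousOn_transform hβ₁ hu
  have hcont : ContinuousOn (concavityFn (transform β u)) (triples Ω) := by
    unfold concavityFn
    refine ((hv.comp (by fun_prop) ?_).sub (ContinuousOn.mul (by fun_prop)
      (hv.comp (by fun_prop) ?_))).sub (ContinuousOn.mul (by fun_prop)
      (hv.comp (by fun_prop) ?_))
    · intro q hq
      exact hcc hq.2.1 hq.1 hq.2.2.1 (by linarith [hq.2.2.2]) (by ring)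
    · exact fun q hq => hq.2.1
    · exact fun q hq => hq.1
  have h00 : (x₀, x₀, (0 : ℝ)) ∈ triples Ω :=
    ⟨subset_closure hx₀, subset_closure hx₀, le_rfl, zero_le_one⟩
  obtain ⟨⟨x₁, x₃, t⟩, ⟨h₁, h₃, ht⟩, hmax⟩ := hcomp.exists_isMaxOn ⟨_, h00⟩ hcont
  simp only at h₁ h₃ ht
  have h0le : 0 ≤ concavityFn (transform β u) (x₁, x₃, t) := by
    have := hmax h00
    simpa [concavityFn] using this
  -- A maximum with value `0` is also attained at the degenerate triple `(x₀, x₀, 0)`.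
  rcases h0le.eq_or_lt with h0 | hpos
  · refine ⟨x₀, hx₀, x₀, hx₀, 0, ⟨le_rfl, zero_le_one⟩, fun q hq => ?_⟩
    have h1 : concavityFn (transform β u) q ≤ concavityFn (transform β u) (x₁, x₃, t) := hmax hq
    have h2 : concavityFn (transform β u) (x₀, x₀, 0) = 0 := by simp [concavityFn]
    rw [Set.mem_ofPred_eq, h2]
    linarith
  have ht0 : 0 < t := ht.1.lt_of_ne (by rintro rfl; simp [concavityFn] at hpos)
  have ht1 : t < 1 := ht.2.lt_of_ne (by rintro rfl; simp [concavityFn] at hpos)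
  have hne : x₁ ≠ x₃ := by
    rintro rfl
    have e : t • x₁ + (1 - t) • x₁ = x₁ := by module
    simp only [concavityFn, e] at hpos
    linarith
  have hfr : ∀ x ∈ closure Ω, x ∉ Ω → x ∈ frontier Ω := fun x hx hx' => by
    rw [hΩ.isOpen.frontier_eq]; exact ⟨hx, hx'⟩
  have hzero : ∀ x ∈ frontier Ω, transform β u x = 0 := fun x hx => by
    rw [transform, hu.u_boundary x hx, Real.zero_rpow (by linarith), neg_zero]
  by_cases hx₁ : x₁ ∈ Ω
  · by_cases hx₃ : x₃ ∈ Ω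
    · exact ⟨x₁, hx₁, x₃, hx₃, t, ht, hmax⟩
    · exact (not_isMaxOn_of_mem_frontier hβ₀ hβ₁ hΩ hu hvar (hfr x₃ h₃ hx₃) hx₁
        (t := 1 - t) ⟨by linarith, by linarith⟩ (isMaxOn_concavityFn_symm hmax)).elim
  · by_cases hx₃ : x₃ ∈ Ω
    · exact (not_isMaxOn_of_mem_frontier hβ₀ hβ₁ hΩ hu hvar (hfr x₁ h₁ hx₁) hx₃
        ⟨ht0, ht1⟩ hmax).elim
    · -- Both end points on the boundary: the value is `v` at an interior point, hence negative.
      exfalso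
      have hx₂ : t • x₃ + (1 - t) • x₁ ∈ Ω := by
        have := hΩ.strictConvex_closure h₃ h₁ hne.symm ht0 (by linarith : 0 < 1 - t) (by ring)
        rwa [hΩ.convex.interior_closure_eq_interior_of_nonempty_interior
          (by rw [hΩ.isOpen.interior_eq]; exact hΩ.nonempty), hΩ.isOpen.interior_eq] at this
      have hlt : transform β u (t • x₃ + (1 - t) • x₁) < 0 :=
        neg_neg_of_pos (Real.rpow_pos_of_pos (hu.u_pos _ hx₂) _)
      simp only [concavityFn, hzero x₁ (hfr x₁ h₁ hx₁), hzero x₃ (hfr x₃ h₃ hx₃)] at hpos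
      linarith

theorem frontier_nonempty_of_isSolution (hΩ : IsAdmissibleDomain Ω)
    (hu : IsSolution Ω β a α u) : (frontier Ω).Nonempty := by
  refine nonempty_frontier_iff.mpr ⟨hΩ.nonempty, fun huniv => ?_⟩
  rcases n with - | n
  · -- In dimension `0` the equation reads `0 = a u ^ β`.
    obtain ⟨x, hx⟩ := hΩ.nonempty
    have h := hu.equation x hx
    have := mul_pos (hu.a_pos x hx) (Real.rpow_pos_of_pos (hu.u_pos x hx) β)
    simp at h
    rcases h with h | h
    · exact (hu.a_pos x hx).ne' h
    · exact (Real.rpow_pos_of_pos (hu.u_pos x hx) β).ne' h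
  · exact NormedSpace.unbounded_univ ℝ (E (n + 1)) (huniv ▸ hΩ.isBounded)

theorem eventually_forall_abs_le {S : Set (E n)} (hS : IsCompact S) {f : E n → ℝ}
    (hf : ContinuousOn f S) : ∀ᶠ K : ℝ in Filter.atTop, ∀ x ∈ S, |f x| ≤ K := by
  obtain ⟨C, hC⟩ := hS.exists_bound_of_continuousOn hf
  filter_upwards [Filter.eventually_ge_atTop C] with K hK x hx using (hC x hx).trans hK

theorem exists_isControl (hβ₀ : 0 ≤ β) (hβ₁ : β < 1) (hΩ : IsAdmissibleDomain Ω)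
    (hu : IsSolution Ω β a α u) (hvar : variation Ω a α < ⊤) :
    ∃ ρ K : ℝ, 0 < ρ ∧ IsControl Ω β a α u ρ K := by
  obtain ⟨x₁, h₁, x₃, h₃, t, ht, hmax⟩ := exists_interior_max hβ₀ hβ₁ hΩ hu hvar
  obtain ⟨ρ, hρ, h₁ρ, h₃ρ⟩ := exists_pos_mem_innerSet hΩ.isOpen
    (frontier_nonempty_of_isSolution hΩ hu) h₁ h₃
  have hS := isCompact_innerSet hΩ.isOpen hΩ.isBounded hρ
  have hsub : innerSet Ω ρ ⊆ Ω := fun x hx => hx.1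
  have ha := hu.a_C1.continuousOn.mono hsub
  have huc := hu.u_C2.continuousOn.mono hsub
  have hgrad : ContinuousOn (fun x => ‖gradient u x‖) (innerSet Ω ρ) :=
    ((InnerProductSpace.toDual ℝ (E n)).symm.continuous.comp_continuousOn
      ((hu.u_C2.continuousOn_fderiv_of_isOpen hΩ.isOpen one_le_two).mono hsub)).norm
  have hD2 : ∀ i j, ContinuousOn (partialD2 i j u) (innerSet Ω ρ) := by
    intro i j
    have h1 : ContDiffOn ℝ 1 (fderiv ℝ u) Ω := hu.u_C2.fderiv_of_isOpen hΩ.isOpen (by norm_num)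
    have h2 := (h1.continuousOn_fderiv_of_isOpen hΩ.isOpen le_rfl).mono hsub
    refine ContinuousOn.congr (f := fun x => fderiv ℝ (fderiv ℝ u) x (EuclideanSpace.single i 1)
      (EuclideanSpace.single j 1))
      ((h2.clm_apply continuousOn_const).clm_apply continuousOn_const) fun x hx => ?_
    exact partialD2_eq (hu.u_C2.contDiffAt (hΩ.isOpen.mem_nhds (hsub hx))) i j
  obtain ⟨K, hK0, hKd, hKa, hKa', hKu, hKu', hKg, hKα, hKD⟩ := ((Filter.eventually_gt_atTop 0).and
    ((Filter.eventually_ge_atTop (Metric.diam Ω)).and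
    ((eventually_forall_abs_le hS ha).and
    ((eventually_forall_abs_le hS (ha.inv₀ fun x hx => (hu.a_pos x hx.1).ne')).and
    ((eventually_forall_abs_le hS huc).and
    ((eventually_forall_abs_le hS (huc.inv₀ fun x hx => (hu.u_pos x hx.1).ne')).and
    ((eventually_forall_abs_le hS hgrad).and
    ((Filter.eventually_all.mpr fun i => Filter.eventually_all.mpr fun j =>
      eventually_forall_abs_le hS ((hu.α_C1 i j).continuousOn.mono hsub)).and
    (Filter.eventually_all.mpr fun i => Filter.eventually_all.mpr fun j =>
      eventually_forall_abs_le hS (hD2 i j)))))))))).exists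
  have hinv : ∀ s : ℝ, 0 < s → |s⁻¹| ≤ K → K⁻¹ ≤ s := fun s hs h =>
    inv_le_of_inv_le₀ hs ((le_abs_self _).trans h)
  exact ⟨ρ, K, hρ,
    { exists_max := ⟨x₁, h₁ρ, x₃, h₃ρ, t, ht, hmax⟩
      diam_le := hKd
      a_bounds := fun x hx =>
        ⟨hinv _ (hu.a_pos x hx.1) (hKa' x hx), (le_abs_self _).trans (hKa x hx)⟩
      α_bound := fun x hx i j => hKα i j x hx
      u_bounds := fun x hx =>
        ⟨hinv _ (hu.u_pos x hx.1) (hKu' x hx), (le_abs_self _).trans (hKu x hx)⟩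
      Du_bound := fun x hx => (le_abs_self _).trans (hKg x hx)
      D2u_bound := fun x hx i j => hKD i j x hx }⟩

end Control

end AlmostConcave

theorem proposition3p2 (n : ℕ) (β : ℝ) (hβ₀ : 0 ≤ β) (hβ₁ : β < 1) :
    ∃ C : ℝ → ℝ, (∀ K, 0 < C K) ∧
      ∀ (Ω : Set (AlmostConcave.E n)) (a : AlmostConcave.E n → ℝ)
        (α : Fin n → Fin n → AlmostConcave.E n → ℝ) (u : AlmostConcave.E n → ℝ),
        AlmostConcave.IsAdmissibleDomain Ω →
        AlmostConcave.IsSolution Ω β a α u →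
        AlmostConcave.variation Ω a α < ⊤ →
        (∃ ρ K : ℝ, 0 < ρ ∧ AlmostConcave.IsControl Ω β a α u ρ K) ∧
        ∀ ρ K : ℝ, 0 < ρ → AlmostConcave.IsControl Ω β a α u ρ K →
          ∀ ε : ℝ, 0 < ε → AlmostConcave.variation Ω a α < ENNReal.ofReal ε →
            (∃ M : ℝ,
              IsGreatest (AlmostConcave.concavityFn (AlmostConcave.transform β u) ''
                AlmostConcave.triples Ω) M ∧
              M ≤ C K * ε) ∧
            ∃ w : AlmostConcave.E n → ℝ, ConcaveOn ℝ Ω w ∧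
              ∀ x ∈ Ω, |u x ^ ((1 - β) / 2) - w x| ≤ C K * ε := by
  -- The absolute value and the summand `1` only serve to make `C K` positive for every real `K`.
  refine ⟨fun K => (n + 2) * |AlmostConcave.defectConst n ((1 - β) / 2) K| + 1,
    fun K => by positivity, fun Ω a α u hΩ hu hvar =>
      ⟨AlmostConcave.exists_isControl hβ₀ hβ₁ hΩ hu hvar, fun ρ K hρ hK ε hε0 hε => ?_⟩⟩
  obtain ⟨x₁, h₁, x₃, h₃, t, ht, hmax⟩ := hK.exists_max
  have hmem : (x₁, x₃, t) ∈ AlmostConcave.triples Ω :=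
    ⟨subset_closure h₁.1, subset_closure h₃.1, ht⟩
  have hbound := AlmostConcave.concavityFn_le_of_isControl hβ₀ hβ₁ hΩ.isOpen hΩ.convex
    hΩ.isBounded hu hρ hK hε0 hε hmem
  set M := AlmostConcave.concavityFn (AlmostConcave.transform β u) (x₁, x₃, t) with hM
  set c := |AlmostConcave.defectConst n ((1 - β) / 2) K| with hc
  have hc0 : 0 ≤ c := abs_nonneg _
  have hMc : M ≤ c * ε :=
    hbound.trans (mul_le_mul_of_nonneg_right (le_abs_self _) hε0.le)
  have hM0 : 0 ≤ M := by
    have h : AlmostConcave.concavityFn (AlmostConcave.transform β u) (x₁, x₁, 0) ≤ M :=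
      hmax ⟨subset_closure h₁.1, subset_closure h₁.1, le_rfl, zero_le_one⟩
    simpa [AlmostConcave.concavityFn] using h
  have hcε : 0 ≤ c * ε := by positivity
  have hn : (0 : ℝ) ≤ n := n.cast_nonneg
  refine ⟨⟨M, ⟨⟨_, hmem, rfl⟩, ?_⟩, ?_⟩, ?_⟩
  · rintro _ ⟨q, hq, rfl⟩
    exact hmax hq
  · nlinarith [mul_nonneg hn hcε]
  · obtain ⟨h, hconv, hnear⟩ := AlmostConcave.exists_convexOn_near_of_approx_convex hΩ.convex hM0
      (v := AlmostConcave.transform β u) fun x hx y hy s hs => by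
        have h : AlmostConcave.concavityFn (AlmostConcave.transform β u) (x, y, s) ≤ M :=
          hmax ⟨subset_closure hx, subset_closure hy, hs⟩
        simp only [AlmostConcave.concavityFn] at h
        linarith
    refine ⟨-h, hconv.neg, fun x hx => ?_⟩
    have e : u x ^ ((1 - β) / 2) - (-h) x = -(AlmostConcave.transform β u x - h x) := by
      rw [AlmostConcave.transform, Pi.neg_apply]; ring
    rw [e, abs_neg]
    calc _ ≤ (n + 2) * M := hnear x hx
      _ ≤ (n + 2) * (c * ε) := by gcongr
      _ ≤ ((n + 2) * c + 1) * ε := by linarith
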